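/- Let $\Lambda$ be a finite set, let $\Phi=\{\varphi_i(x)=A_ix+b_i\}_{i\in\Lambda}$ be invertible affine maps of $\mathbb R^2$ that are strict contractions in the Euclidean norm and have no common fixed point, and let $p=(p_i)_{i\in\Lambda}$ be a probability vector with $p_i>0$ for all $i$. Assume that $\Phi$ is non-conformal (in no affine coordinate system are all the $\varphi_i$ similarities) and totally irreducible (no nonempty finite set of lines through the origin is invariant under all the $A_i$). Let $\xi=p^{\mathbb N}$ on $\Lambda^{\mathbb N}$, let $\Pi(\omega)=\lim_n\varphi_{\omega_1}\cdots\varphi_{\omega_n}(0)$, and let $\mu=\Pi\xi$ be the self-affine measure, i.e. the unique Borel probability measure with $\mu=\sum_i p_i\,\varphi_i\mu$. Assume $\dim\mu<2$, where $\dim\mu=\inf\{\dim_H E:\ E\text{ Borel},\ \mu(E)>0\}$. For a matrix $A$ with singular values $\alpha_1>\alpha_2$, let $L(A)\in\mathbb{RP}^1$ be the direction of the major axis of the image of the unit ball, i.e. the line spanned by $Ve_1$ if $A=V\,\mathrm{diag}(\alpha_1,\alpha_2)\,U$ is a singular value decomposition; for $\omega\in\Lambda^{\mathbb N}$ let $L(\omega)=\lim_n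 L(A_{\omega_1}\cdots A_{\omega_n})$ whenever this is defined for all large $n$ and converges in $\mathbb{RP}^1$ (with metric $d(V,W)=\|\pi_V-\pi_W\|$, $\pi_V$ the orthogonal projection to $V$). Let $\xi=\int\xi_x\,d\mu(x)$ be the disintegration of $\xi$ over the fibres $\Pi^{-1}(x)$. The direction function is the function $x\mapsto L(x)\in\mathbb{RP}^1$ for which $L(x)$ is the $\xi_x$-almost surely constant value of $\omega\mapsto L(\omega)$; $L(x)$ is left undefined at points where there is no such value, and sets defined below through $L(x)$ consist of points at which $L(x)$ is defined. Let $A^{vec}_{2,2}$ be the vector space of affine maps $\mathbb R^2\to\mathbb R^2$ with the norm $\|\psi\|=\max\{|\psi(0)|,\|A_\psi\|\}$, where $\psi(x)=A_\psi x+\psi(0)$. For a Borel probability measure $\theta$ on $A^{vec}_{2,2}$ and $x\in\mathbb R^2$, let $\theta.x$ be the push-forward of $\theta$ under $\psi\mapsto\psi(x)$. For a linear subspace $W\le\mathbb R^2$ and $\delta>0$, a probability measure $\nu$ on $\mathbb R^2$ is $(W,\delta)$-concentrated if there is $v\in\mathbb R^2$ such that the set of points at distance less than $\delta$ from $W+v$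 has $\nu$-mass at least $1-\delta$. Then: 1. For every $0\ne\psi\in A^{vec}_{2,2}$, $$\mu\left(x:\ \psi(x)\neq 0\text{ and }L(x)=\mathbb R\psi(x)\right)=0 .$$ That is, $L$ does not agree with $x\mapsto\overline{\psi}(x)=\mathbb R\psi(x)$ on a set of positive $\mu$-measure. 2. For every $\varepsilon,R>0$ there is $\delta>0$ such that for every Borel probability measure $\theta$ on $A^{vec}_{2,2}$ that is supported on a set of diameter at most $R$ and satisfies $$\mu\left(x:\ \theta.x\text{ is not }(\{0\},\varepsilon)\text{-concentrated}\right)>\varepsilon ,$$ one has $$\mu\left(x:\ \theta.x\text{ is }(L(x),\delta)\text{-concentrated}\right)\le 1-\delta .$$ -/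

import Mathlib

open MeasureTheory ProbabilityTheory Filter Topology
open scoped NNReal ENNReal

noncomputable section

/-- The Euclidean plane `ℝ²`. -/
abbrev Plane : Type := EuclideanSpace ℝ (Fin 2)

/-- The projective line: the space of lines through the origin in the plane. -/
abbrev RP1 : Type := Projectivization ℝ Plane

/-- The metric `d(V, W) = ‖π_V - π_W‖` (operator norm of the difference of the orthogonal
projections) on the projective line. -/
def distRP1 (V W : RP1) : ℝ :=
  ‖V.submodule.starProjection - W.submodule.starProjection‖

/-- The normed space of all affine maps of the plane to itself. -/
abbrev AffVec : Type := Plane →ᴬ[ℝ] Plane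

instance instMeasurableSpaceAffVec : MeasurableSpace AffVec := borel AffVec

instance instBorelSpaceAffVec : BorelSpace AffVec := ⟨rfl⟩

/-- For a probability measure `θ` on affine maps and a point `x`, the measure `θ.x`: the
push-forward of `θ` under the evaluation `ψ ↦ ψ x`. -/
def evalMeasure (θ : Measure AffVec) (x : Plane) : Measure Plane :=
  θ.map (fun ψ : AffVec => ψ x)

/-- `ν` is `(W, δ)`-concentrated: some translate `W + v` has `1 - δ` of the mass of `ν` within
distance `δ`. -/
def IsConcentrated (W : Submodule ℝ Plane) (δ : ℝ) (ν : Measure Plane) : Prop :=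
  ∃ v : Plane, 1 - δ ≤ ν.real (Metric.thickening δ ((fun w : Plane => w + v) '' (W : Set Plane)))

/-- The measure `θ` is supported on a set of diameter at most `R`. -/
def SupportedInDiam (θ : Measure AffVec) (R : ℝ) : Prop :=
  ∃ S : Set AffVec, Metric.ediam S ≤ ENNReal.ofReal R ∧ θ Sᶜ = 0

/-- `ℓ = L(A)` is the major axis direction of `A`: there is a singular value decomposition
`A = V ∘ diag(a, b) ∘ U` with `a > b` and `ℓ` is the line spanned by `V e₁`. -/
def IsMajorAxis (A : Plane →ₗ[ℝ] Plane) (ℓ : RP1) : Prop :=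
  ∃ (V U : Plane ≃ₗᵢ[ℝ] Plane) (a b : ℝ), 0 ≤ b ∧ b < a ∧
    (∀ x : Plane, A x = V !₂[a * U x 0, b * U x 1]) ∧
    ℓ.submodule = Submodule.span ℝ {V !₂[1, 0]}

section System

variable {Λ : Type*}

/-- The composition `φ_{ω₀} ∘ ⋯ ∘ φ_{ω_{n-1}}` along the first `n` letters of `ω`. -/
def word (φ : Λ → Plane ≃ᵃ[ℝ] Plane) (ω : ℕ → Λ) : ℕ → Plane ≃ᵃ[ℝ] Plane
  | 0 => 1
  | n + 1 => word φ ω n * φ (ω n)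

/-- The coding map `Π(ω) = lim φ_{ω₀} ∘ ⋯ ∘ φ_{ω_{n-1}} (0)`. -/
def codingMap (φ : Λ → Plane ≃ᵃ[ℝ] Plane) (ω : ℕ → Λ) : Plane :=
  limUnder atTop (fun n => word φ ω n 0)

/-- There is no coordinate system (affine change of coordinates `g`) in which all the maps `φ i`
are similarities. -/
def NonConformal (φ : Λ → Plane ≃ᵃ[ℝ] Plane) : Prop :=
  ¬ ∃ g : Plane ≃ᵃ[ℝ] Plane, ∀ i, ∃ r : ℝ, ∀ x y : Plane,
    dist (g (φ i (g.symm x))) (g (φ i (g.symm y))) = r * dist x y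

/-- There is no nonempty finite set of lines through the origin which is invariant under all the
linear parts of the maps `φ i`. -/
def TotallyIrreducible (φ : Λ → Plane ≃ᵃ[ℝ] Plane) : Prop :=
  ¬ ∃ S : Set RP1, S.Finite ∧ S.Nonempty ∧ ∀ i, ∀ ℓ ∈ S, ∃ ℓ' ∈ S,
    ℓ'.submodule = ℓ.submodule.map ((φ i).linear : Plane →ₗ[ℝ] Plane)

/-- `V` is the direction `L(ω) = lim L(A_{ω₀} ⋯ A_{ω_{n-1}})` of the infinite word `ω`; here the
major axes are required to be defined for all large `n`. -/
def IsWordDirection (φ : Λ → Plane ≃ᵃ[ℝ] Plane) (ω : ℕ → Λ) (V : RP1) : Prop :=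
  ∃ ℓ : ℕ → RP1,
    (∀ᶠ n in atTop, IsMajorAxis ((word φ ω n).linear : Plane →ₗ[ℝ] Plane) (ℓ n)) ∧
    Tendsto (fun n => distRP1 (ℓ n) V) atTop (𝓝 0)

variable [MeasurableSpace Λ]

/-- The product measure `ξ = p^ℕ` on infinite words. -/
def wordMeasure (p : PMF Λ) : Measure (ℕ → Λ) :=
  Measure.infinitePi (fun _ : ℕ => p.toMeasure)

instance instIsProbabilityMeasureWordMeasure (p : PMF Λ) :
    IsProbabilityMeasure (wordMeasure p) := by
  unfold wordMeasure
  infer_instance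

/-- The self-affine measure `μ = Πξ`, i.e. the unique probability measure with
`μ = ∑ i, p i • φ i μ`. -/
def selfAffineMeasure (φ : Λ → Plane ≃ᵃ[ℝ] Plane) (p : PMF Λ) : Measure Plane :=
  (wordMeasure p).map (codingMap φ)

/-- The relation `L(x) = V` for the direction function `L` on the plane. With `ξ = ∫ ξ_x dμ(x)` the
disintegration of `ξ` over the fibres of the coding map `Π`, the value `L(x)` is the
`ξ_x`-almost sure constant value of the word direction `ω ↦ L(ω)`. It is a partially defined
function: `x` has at most one direction, because `ξ_x` is a probability measure and word
directions are unique. -/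
def IsDirectionAt [Fintype Λ] [Nonempty Λ] [DiscreteMeasurableSpace Λ]
    (φ : Λ → Plane ≃ᵃ[ℝ] Plane) (p : PMF Λ) (x : Plane) (V : RP1) : Prop :=
  ∀ᵐ ω ∂(condDistrib id (codingMap φ) (wordMeasure p) x), IsWordDirection φ ω V

end System

/-- The (lower Hausdorff) dimension of a measure: the infimum of the Hausdorff dimensions of the
sets of positive measure. For exact dimensional measures, such as self-affine measures, it is the
almost sure local dimension. -/
def measureDim (μ : Measure Plane) : ℝ≥0∞ :=
  ⨅ (s : Set Plane) (_ : MeasurableSet s) (_ : 0 < μ s), dimH s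

end

/-! Everything is lifted from the plane to words. For a word `ω` let `Mₙ` be the linear part of its
`n`-th prefix. A vector `v` is slow if `‖Mₙ⁻¹ v‖ = o(‖Mₙ⁻¹‖)`; the slow vectors form a proper
subspace, `slowSpace`. The limit direction `L(ω)` almost surely lies in it
(`ae_wordDirection_le_slowSpace`). This holds because `Mₙ⁻¹` is smallest along the major axis of
`Mₙ`, provided the condition numbers tend to infinity wherever `L(ω)` exists. If they did not,
Lévy's zero-one law and compactness would produce an orthogonal pair that all inverse words keep
orthogonal, which non-conformality and total irreducibility exclude (`false_of_orthogonal`).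

The core is `measure_slowSet_eq_zero`: for `ψ ≠ 0` the event that `ψ(Π ω)` is slow is null. This
event is self-similar: after a prefix with map `g` and linear part `A` it becomes the same event for
`A⁻¹ ∘ ψ ∘ g`. If it had positive probability, zooming in at a density point, normalizing and using
compactness of the unit sphere would give some `ψ₀ ≠ 0` for which it is almost sure. The maps with
that property form a nonzero linear space `W`, invariant under `ψ ↦ A_i⁻¹ ∘ ψ ∘ φ_i`.

Algebra rules `W` out (`false_of_invariant_subspace`) by means of the invariant form given by the
trace of the product of linear parts. If it is nondegenerate on `W`, its Casimir element is an
affine map `ψ` with `ψ ∘ φ_i = A_i ∘ ψ` and nonzero linear part; its zero is a common fixed point,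
or its kernel is an invariant line. If it is degenerate, a radical element is either a constant,
which spans an invariant line, or has an isotropic linear part `C`. As the form has signature (3,1),
the conjugates of `C` are multiples of `C`, which yields an invariant line or an invariant complex
structure.

The first claim follows by disintegration. For the second, compactness makes the null statement
uniform over unit `ψ`. If `θ.x` is concentrated along `L(x)` for most `x`, then differences of two
independent samples of `θ` map most points near the slow direction, so by Fubini most differences
are small. Then `θ` itself is concentrated, and so is `θ.x` for `μ`-almost every `x`. -/

set_option linter.unusedSectionVars false

/-! ### Words and the product measure -/

section Words

variable {Λ : Type*}

/-- The sequence whose first `n` letters are those of `ω`, followed by `η`. -/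
def concat (n : ℕ) (ω η : ℕ → Λ) : ℕ → Λ := fun k => if k < n then ω k else η (k - n)

theorem concat_of_lt {n k : ℕ} (ω η : ℕ → Λ) (h : k < n) : concat n ω η k = ω k := if_pos h

theorem concat_add (n k : ℕ) (ω η : ℕ → Λ) : concat n ω η (n + k) = η k := by
  simp [concat]

theorem word_congr (φ : Λ → Plane ≃ᵃ[ℝ] Plane) {n : ℕ} {ω ω' : ℕ → Λ}
    (h : ∀ k < n, ω k = ω' k) : word φ ω n = word φ ω' n := by
  induction n with
  | zero => rfl
  | succ n ih =>
    simp only [word]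
    rw [ih fun k hk => h k (by omega), h n (by omega)]

theorem word_concat (φ : Λ → Plane ≃ᵃ[ℝ] Plane) (n k : ℕ) (ω η : ℕ → Λ) :
    word φ (concat n ω η) (n + k) = word φ ω n * word φ η k := by
  induction k with
  | zero =>
    simp only [word, add_zero, mul_one]
    exact word_congr φ fun k hk => concat_of_lt ω η hk
  | succ k ih => rw [← add_assoc, word, ih, concat_add, word, mul_assoc]

theorem word_one (φ : Λ → Plane ≃ᵃ[ℝ] Plane) (ω : ℕ → Λ) : word φ ω 1 = φ (ω 0) := by
  simp [word]

variable [Fintype Λ] [Nonempty Λ] [MeasurableSpace Λ] [DiscreteMeasurableSpace Λ]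

theorem measurable_cylinderEvents_of_prefix {β : Type*} [MeasurableSpace β] (n : ℕ)
    (f : (ℕ → Λ) → β) (hf : ∀ ω ω' : ℕ → Λ, (∀ k < n, ω k = ω' k) → f ω = f ω') :
    Measurable[cylinderEvents (Set.Iio n)] f := by
  classical
  have h : f = (fun v : Fin n → Λ =>
      f (fun k => if h : k < n then v ⟨k, h⟩ else Classical.arbitrary Λ)) ∘
      (fun (ω : ℕ → Λ) (i : Fin n) => ω i) := by
    funext ω
    exact hf _ _ fun k hk => by simp [hk]
  rw [h]
  refine (Measurable.of_discrete).comp ?_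
  refine @measurable_pi_lambda _ _ _ (cylinderEvents (Set.Iio n)) _ _ fun i => ?_
  exact measurable_cylinderEvent_apply i.2

theorem measurable_of_prefix {β : Type*} [MeasurableSpace β] (n : ℕ)
    (f : (ℕ → Λ) → β) (hf : ∀ ω ω' : ℕ → Λ, (∀ k < n, ω k = ω' k) → f ω = f ω') :
    Measurable f :=
  (measurable_cylinderEvents_of_prefix n f hf).mono cylinderEvents_le_pi le_rfl

theorem measurable_concat (n : ℕ) :
    Measurable (fun q : (ℕ → Λ) × (ℕ → Λ) => concat n q.1 q.2) := by
  refine measurable_pi_lambda _ fun k => ?_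
  by_cases h : k < n
  · simp only [concat, if_pos h]; fun_prop
  · simp only [concat, if_neg h]; fun_prop

/-- The prefix and the tail are independent: the preimage of a box is a box in the first `n` letters
times a box, with indices shifted by `n`, in the tail. -/
theorem measurePreserving_concat (p : PMF Λ) (n : ℕ) :
    MeasurePreserving (fun q : (ℕ → Λ) × (ℕ → Λ) => concat n q.1 q.2)
      ((wordMeasure p).prod (wordMeasure p)) (wordMeasure p) := by
  classical
  refine ⟨measurable_concat n, ?_⟩
  refine Measure.eq_infinitePi _ fun s t ht => ?_
  rw [Measure.map_apply (measurable_concat n)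
    (MeasurableSet.pi s.countable_toSet fun i _ => ht i)]
  have h : (fun q : (ℕ → Λ) × (ℕ → Λ) => concat n q.1 q.2) ⁻¹' ((s : Set ℕ).pi t) =
      (((s.filter (· < n) : Finset ℕ) : Set ℕ).pi t) ×ˢ
      ((((s.filter (¬ · < n)).image (· - n) : Finset ℕ) : Set ℕ).pi fun j => t (j + n)) := by
    ext ⟨ω, η⟩
    simp only [Set.mem_preimage, Set.mem_pi, Finset.mem_coe, Set.mem_prod, Finset.mem_filter,
      Finset.mem_image, concat]
    constructor
    · intro h
      refine ⟨fun i hi => ?_, ?_⟩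
      · have := h i hi.1
        rwa [if_pos hi.2] at this
      · rintro j ⟨i, hi, rfl⟩
        have := h i hi.1
        rwa [if_neg hi.2, ← Nat.sub_add_cancel (not_lt.1 hi.2), Nat.add_sub_cancel] at this
    · rintro ⟨h1, h2⟩ i hi
      split_ifs with hin
      · exact h1 i ⟨hi, hin⟩
      · have := h2 (i - n) ⟨i, ⟨hi, hin⟩, rfl⟩
        rwa [Nat.sub_add_cancel (not_lt.1 hin)] at this
  rw [h, Measure.prod_prod]
  unfold wordMeasure
  rw [Measure.infinitePi_pi _ fun i _ => ht i, Measure.infinitePi_pi _ fun i _ => ht _,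
    Finset.prod_image, ← Finset.prod_filter_mul_prod_filter_not s (· < n)]
  · congr 1
    refine Finset.prod_congr rfl fun i hi => ?_
    rw [Nat.sub_add_cancel (not_lt.1 (Finset.mem_filter.1 hi).2)]
  · intro i hi j hj hij
    have := (Finset.mem_filter.1 hi).2
    have := (Finset.mem_filter.1 hj).2
    simp only at hij
    omega

theorem measurableSet_concat_preimage (n : ℕ) (ω : ℕ → Λ) {E : Set (ℕ → Λ)}
    (hE : MeasurableSet E) : MeasurableSet {η | concat n ω η ∈ E} :=
  ((measurable_concat n).comp measurable_prodMk_left) hE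

/-- Lévy's zero-one law for words. -/
theorem tendsto_measureReal_concat (p : PMF Λ) {E : Set (ℕ → Λ)} (hE : MeasurableSet E) :
    ∀ᵐ ω ∂(wordMeasure p), Tendsto
      (fun n => (wordMeasure p).real {η | concat n ω η ∈ E}) atTop
      (𝓝 (E.indicator (fun _ => (1 : ℝ)) ω)) := by
  classical
  let ℱ : Filtration ℕ (MeasurableSpace.pi : MeasurableSpace (ℕ → Λ)) :=
    { seq := fun n => cylinderEvents (Set.Iio n)
      mono' := fun m n h => cylinderEvents_mono (Set.Iio_subset_Iio h)
      le' := fun n => cylinderEvents_le_pi }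
  have hsup : (⨆ n, ℱ n) = MeasurableSpace.pi := by
    refine le_antisymm (iSup_le fun n => ℱ.le n) ?_
    refine iSup_le fun i => ?_
    refine le_trans ?_ (le_iSup (fun n => (ℱ n : MeasurableSpace (ℕ → Λ))) (i + 1))
    exact (measurable_cylinderEvent_apply (X := fun _ : ℕ => Λ) (Δ := Set.Iio (i + 1))
      (show i ∈ Set.Iio (i + 1) from Nat.lt_succ_self i)).comap_le
  set ξ := wordMeasure p
  have hint : Integrable (E.indicator (fun _ => (1 : ℝ))) ξ :=
    (integrable_const 1).indicator hE
  have hmeas : ∀ n, Measurable[ℱ n] (fun ω => ξ.real {η | concat n ω η ∈ E}) := by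
    intro n
    refine measurable_cylinderEvents_of_prefix n _ fun ω ω' h => ?_
    have : ∀ η, concat n ω η = concat n ω' η := by
      intro η
      funext k
      unfold concat
      split_ifs with hk
      · exact h k hk
      · rfl
    simp only [this]
  -- By independence, the mass of good continuations is a version of the conditional probability
  -- given the first `n` letters; martingale convergence then applies.
  have hce : ∀ n, (fun ω => ξ.real {η | concat n ω η ∈ E}) =ᵐ[ξ]
      ξ[E.indicator (fun _ => (1 : ℝ)) | ℱ n] := by
    intro n
    have hbd : Integrable (fun ω => ξ.real {η | concat n ω η ∈ E}) ξ := by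
      refine Integrable.of_bound ((hmeas n).mono (ℱ.le n) le_rfl).aestronglyMeasurable 1 ?_
      refine ae_of_all _ fun ω => ?_
      rw [Real.norm_of_nonneg measureReal_nonneg]
      exact measureReal_le_one
    refine ae_eq_condExp_of_forall_setIntegral_eq (ℱ.le n) hint (fun s _ _ => hbd.integrableOn)
      ?_ (hmeas n).stronglyMeasurable.aestronglyMeasurable
    intro s hs _
    have hs' : MeasurableSet s := ℱ.le n s hs
    -- A set in the `n`-th σ-algebra is the preimage of some set of `n`-tuples, so the tail does not
    -- affect membership.
    have hsω : ∀ ω η : ℕ → Λ, concat n ω η ∈ s ↔ ω ∈ s := by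
      have h1 : ∀ ω ω' : ℕ → Λ, (∀ k < n, ω k = ω' k) → (ω ∈ s ↔ ω' ∈ s) := by
        let 𝒢 : MeasurableSpace (ℕ → Λ) := MeasurableSpace.comap
          (fun (ω : ℕ → Λ) (i : Fin n) => ω i) ⊤
        have hle : cylinderEvents (X := fun _ : ℕ => Λ) (Set.Iio n) ≤ 𝒢 := by
          refine iSup₂_le fun i hi => ?_
          rintro _ ⟨t, _, rfl⟩
          exact ⟨{v | v ⟨i, hi⟩ ∈ t}, trivial, rfl⟩
        obtain ⟨t, _, rfl⟩ := hle s hs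
        intro ω ω' h
        have : (fun i : Fin n => ω i) = fun i : Fin n => ω' i := funext fun i => h i i.2
        simp only [Set.mem_preimage, this]
      intro ω η
      exact h1 _ _ fun k hk => concat_of_lt ω η hk
    rw [integral_indicator hE, Measure.restrict_restrict hE, setIntegral_const, smul_eq_mul,
      mul_one, measureReal_def, ← (measurePreserving_concat p n).measure_preimage
        (hE.inter hs').nullMeasurableSet]
    have hpre : (fun q : (ℕ → Λ) × (ℕ → Λ) => concat n q.1 q.2) ⁻¹' (E ∩ s) =
        {q | q.1 ∈ s ∧ concat n q.1 q.2 ∈ E} := by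
      ext q
      simp [hsω, and_comm]
    rw [hpre, Measure.prod_apply (by
      rw [← hpre]; exact measurable_concat n (hE.inter hs'))]
    simp only [measureReal_def]
    have hm : Measurable fun ω => ξ {η | concat n ω η ∈ E} :=
      measurable_measure_prodMk_left (measurable_concat n hE)
    rw [integral_toReal hm.aemeasurable (ae_of_all _ fun ω => measure_lt_top _ _)]
    congr 1
    rw [← lintegral_indicator hs']
    refine lintegral_congr fun ω => ?_
    by_cases h : ω ∈ s
    · simp [h, ξ]
    · simp [h]
  filter_upwards [tendsto_ae_condExp (ℱ := ℱ) (μ := ξ) (E.indicator (fun _ => (1 : ℝ))),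
    ae_all_iff.2 hce] with ω h1 h2
  rw [hsup, condExp_of_stronglyMeasurable le_rfl
    ((stronglyMeasurable_const).indicator hE) hint] at h1
  exact h1.congr fun n => (h2 n).symm

/-- Cylinder sets of positive weights have positive measure. -/
theorem exists_pos_le_measureReal_cylinder (p : PMF Λ) (hp : ∀ i, 0 < p i) (n : ℕ) :
    ∃ c : ℝ, 0 < c ∧ ∀ ω : ℕ → Λ, c ≤ (wordMeasure p).real {η | ∀ k < n, η k = ω k} := by
  classical
  obtain ⟨i₀, hi₀⟩ := Finite.exists_min (fun i => (p i).toReal)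
  have hpos : ∀ i, 0 < (p i).toReal := fun i => ENNReal.toReal_pos (hp i).ne' (p.apply_ne_top i)
  refine ⟨(p i₀).toReal ^ n, pow_pos (hpos _) n, fun ω => ?_⟩
  have h : {η : ℕ → Λ | ∀ k < n, η k = ω k} =
      ((Finset.range n : Finset ℕ) : Set ℕ).pi fun k => {ω k} := by
    ext η; simp [Set.mem_pi]
  rw [h, measureReal_def, wordMeasure, Measure.infinitePi_pi _ fun i _ => .of_discrete,
    ENNReal.toReal_prod]
  calc (p i₀).toReal ^ n = ∏ _i ∈ Finset.range n, (p i₀).toReal := by simp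
    _ ≤ _ := by
      refine Finset.prod_le_prod (fun i _ => (hpos _).le) fun i _ => ?_
      rw [PMF.toMeasure_apply_singleton _ _ (.of_discrete)]
      exact hi₀ _

/-- The cylinder of words starting with `i` has positive mass, so it contains a word for which
almost every tail is good; only the first letter of that word matters. -/
theorem ae_concat_one (p : PMF Λ) (hp : ∀ i, 0 < p i) {E : Set (ℕ → Λ)}
    (h : ∀ᵐ ω ∂(wordMeasure p), ω ∈ E) (i : Λ) :
    ∀ᵐ η ∂(wordMeasure p), concat 1 (fun _ => i) η ∈ E := by
  have h1 := (measurePreserving_concat p 1).quasiMeasurePreserving.ae h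
  have h2 := Measure.ae_ae_of_ae_prod h1
  obtain ⟨c, hc, hcyl⟩ := exists_pos_le_measureReal_cylinder p hp 1
  by_contra hcon
  have h3 : (wordMeasure p).real {η | ∀ k < 1, η k = (fun _ => i : ℕ → Λ) k} = 0 := by
    rw [measureReal_def, measure_mono_null _ (ae_iff.1 h2), ENNReal.toReal_zero]
    intro ω hω h4
    refine hcon (h4.mono fun η hη => ?_)
    convert hη using 1
    funext k
    unfold concat
    split_ifs with hk
    · exact (hω k hk).symm
    · rfl
  have := hcyl (fun _ => i)
  linarith

end Words

/-! ### The coding map -/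

section Coding

variable {Λ : Type*} [Fintype Λ] [Nonempty Λ]

theorem exists_uniform_contraction (φ : Λ → Plane ≃ᵃ[ℝ] Plane)
    (hφ : ∀ i, ∃ K : ℝ≥0, ContractingWith K (φ i)) :
    ∃ K : ℝ≥0, K < 1 ∧ ∀ i, LipschitzWith K (φ i) := by
  choose K hK using hφ
  obtain ⟨i, hi⟩ := Finite.exists_max K
  exact ⟨K i, (hK i).1, fun j => (hK j).2.weaken (hi j)⟩

theorem lipschitzWith_word {φ : Λ → Plane ≃ᵃ[ℝ] Plane} {K : ℝ≥0}
    (hK : ∀ i, LipschitzWith K (φ i)) (ω : ℕ → Λ) (n : ℕ) :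
    LipschitzWith (K ^ n) (word φ ω n) := by
  induction n with
  | zero => simpa [word] using LipschitzWith.id
  | succ n ih =>
    rw [pow_succ]
    exact ih.comp (hK _)

theorem exists_codingMap_bound (φ : Λ → Plane ≃ᵃ[ℝ] Plane)
    (hφ : ∀ i, ∃ K : ℝ≥0, ContractingWith K (φ i)) :
    ∃ C : ℝ, ∀ ω : ℕ → Λ, Tendsto (fun n => word φ ω n 0) atTop (𝓝 (codingMap φ ω)) ∧
      ‖codingMap φ ω‖ ≤ C := by
  obtain ⟨K, hK1, hK⟩ := exists_uniform_contraction φ hφ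
  obtain ⟨i₀, hi₀⟩ := Finite.exists_max fun i => dist (0 : Plane) (φ i 0)
  have hd : ∀ (ω : ℕ → Λ) (n : ℕ), dist (word φ ω n 0) (word φ ω (n + 1) 0) ≤
      dist (0 : Plane) (φ i₀ 0) * (K : ℝ) ^ n := by
    intro ω n
    have h := (lipschitzWith_word hK ω n).dist_le_mul 0 (φ (ω n) 0)
    calc dist (word φ ω n 0) (word φ ω (n + 1) 0) ≤ _ := h
      _ ≤ (K : ℝ) ^ n * dist (0 : Plane) (φ i₀ 0) := by
        push_cast
        gcongr
        exact hi₀ _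
      _ = _ := mul_comm _ _
  refine ⟨dist (0 : Plane) (φ i₀ 0) / (1 - K), fun ω => ?_⟩
  have hc := cauchySeq_of_le_geometric (K : ℝ) _ (by exact_mod_cast hK1) (hd ω)
  have ht : Tendsto (fun n => word φ ω n 0) atTop (𝓝 (codingMap φ ω)) := hc.tendsto_limUnder
  refine ⟨ht, ?_⟩
  have := dist_le_of_le_geometric_of_tendsto₀ (K : ℝ) _ (by exact_mod_cast hK1) (hd ω) ht
  simpa [word] using this

theorem codingMap_concat (φ : Λ → Plane ≃ᵃ[ℝ] Plane)
    (hφ : ∀ i, ∃ K : ℝ≥0, ContractingWith K (φ i)) (n : ℕ) (ω η : ℕ → Λ) :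
    codingMap φ (concat n ω η) = word φ ω n (codingMap φ η) := by
  obtain ⟨C, hC⟩ := exists_codingMap_bound φ hφ
  have h1 := (tendsto_add_atTop_iff_nat n).2 (hC (concat n ω η)).1
  have hcont : Continuous (word φ ω n) := (word φ ω n).continuous_of_finiteDimensional
  have h2 := (hcont.tendsto _).comp (hC η).1
  refine tendsto_nhds_unique h1 (h2.congr fun k => ?_)
  simp only [Function.comp_apply]
  rw [add_comm k n, word_concat]
  rfl

variable [MeasurableSpace Λ] [DiscreteMeasurableSpace Λ]

theorem measurable_codingMap (φ : Λ → Plane ≃ᵃ[ℝ] Plane)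
    (hφ : ∀ i, ∃ K : ℝ≥0, ContractingWith K (φ i)) : Measurable (codingMap φ) := by
  obtain ⟨C, hC⟩ := exists_codingMap_bound φ hφ
  refine measurable_of_tendsto_metrizable (f := fun n ω => word φ ω n 0) (fun n => ?_)
    (tendsto_pi_nhds.2 fun ω => (hC ω).1)
  exact measurable_of_prefix n _ fun ω ω' h => by rw [word_congr φ h]

end Coding

/-! ### Affine maps of the plane -/

section AffineMaps

theorem affVec_apply (ψ : AffVec) (x : Plane) : ψ x = ψ.contLinear x + ψ 0 := by
  have := ψ.map_vadd 0 x
  simpa using this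

theorem continuous_affVec_apply : Continuous fun q : AffVec × Plane => q.1 q.2 := by
  have h : (fun q : AffVec × Plane => q.1 q.2) = fun q : AffVec × Plane =>
      (ContinuousAffineMap.decompLinearIsometryEquiv ℝ ℝ Plane Plane q.1).2 q.2 +
      (ContinuousAffineMap.decompLinearIsometryEquiv ℝ ℝ Plane Plane q.1).1 :=
    funext fun q => affVec_apply q.1 q.2
  rw [h]
  fun_prop

instance instFiniteDimensionalAffVec : FiniteDimensional ℝ AffVec :=
  LinearEquiv.finiteDimensional
    (ContinuousAffineMap.decompLinearIsometryEquiv ℝ ℝ Plane Plane).symm.toLinearEquiv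

instance instProperSpaceAffVec : ProperSpace AffVec := FiniteDimensional.proper ℝ AffVec

instance instSecondCountableTopologyAffVec : SecondCountableTopology AffVec :=
  secondCountable_of_proper

theorem norm_affVec_apply_le (ψ : AffVec) (x : Plane) : ‖ψ x‖ ≤ ‖ψ‖ * (‖x‖ + 1) := by
  rw [affVec_apply, mul_add, mul_one, ContinuousAffineMap.norm_def]
  refine (norm_add_le _ _).trans (add_le_add ?_ (le_max_left _ _))
  exact (ψ.contLinear.le_opNorm x).trans
    (mul_le_mul_of_nonneg_right (le_max_right _ _) (norm_nonneg _))

/-- The inverse of the linear part of an affine automorphism. -/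
noncomputable def invLin (g : Plane ≃ᵃ[ℝ] Plane) : Plane →L[ℝ] Plane :=
  LinearMap.toContinuousLinearMap (g.linear.symm : Plane →ₗ[ℝ] Plane)

theorem invLin_apply (g : Plane ≃ᵃ[ℝ] Plane) (v : Plane) : invLin g v = g.linear.symm v := rfl

theorem invLin_mul (g h : Plane ≃ᵃ[ℝ] Plane) : invLin (g * h) = invLin h ∘L invLin g := by
  ext1 v
  rfl

theorem invLin_one : invLin 1 = ContinuousLinearMap.id ℝ Plane := by
  ext1 v
  rfl

theorem invLin_eq_zero_iff (g : Plane ≃ᵃ[ℝ] Plane) (v : Plane) : invLin g v = 0 ↔ v = 0 := by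
  rw [invLin_apply, LinearEquiv.map_eq_zero_iff]

theorem norm_invLin_pos (g : Plane ≃ᵃ[ℝ] Plane) : 0 < ‖invLin g‖ := by
  rw [norm_pos_iff]
  intro h
  obtain ⟨v, hv⟩ := exists_ne (0 : Plane)
  exact hv ((invLin_eq_zero_iff g v).1 (by rw [h]; rfl))

/-- The action `ψ ↦ A⁻¹ ∘ ψ ∘ g` on affine maps, with `A` the linear part of `g`. -/
noncomputable def pull (g : Plane ≃ᵃ[ℝ] Plane) : AffVec →ₗ[ℝ] AffVec where
  toFun ψ := (invLin g).toContinuousAffineMap.comp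
    (ψ.comp ⟨(g : Plane →ᵃ[ℝ] Plane), g.continuous_of_finiteDimensional⟩)
  map_add' ψ ψ' := by
    ext1 x
    exact (invLin g).map_add _ _
  map_smul' c ψ := by
    ext1 x
    exact (invLin g).map_smul _ _

theorem pull_apply (g : Plane ≃ᵃ[ℝ] Plane) (ψ : AffVec) (x : Plane) :
    pull g ψ x = invLin g (ψ (g x)) := rfl

theorem pull_injective (g : Plane ≃ᵃ[ℝ] Plane) : Function.Injective (pull g) := by
  rw [← LinearMap.ker_eq_bot, LinearMap.ker_eq_bot']
  intro ψ h
  ext1 x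
  have h1 := congrArg (fun ψ : AffVec => ψ (g.symm x)) h
  simp only [pull_apply, AffineEquiv.apply_symm_apply] at h1
  exact (invLin_eq_zero_iff g _).1 h1

end AffineMaps

/-! ### Directions of slow growth of the inverse cocycle -/

section Growth

variable {Λ : Type*} (φ : Λ → Plane ≃ᵃ[ℝ] Plane)

/-- `limsup ‖Mₙ⁻¹ v‖ / ‖Mₙ⁻¹‖ ≤ t`, where `Mₙ` is the linear part of the `n`-th prefix of `ω`. -/
def GrowthLE (ω : ℕ → Λ) (t : ℝ) (v : Plane) : Prop :=
  ∀ r > t, ∀ᶠ n in atTop, ‖invLin (word φ ω n) v‖ ≤ r * ‖invLin (word φ ω n)‖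

variable {φ} {ω : ℕ → Λ}

theorem GrowthLE.mono {t t' : ℝ} {v : Plane} (h : GrowthLE φ ω t v) (ht : t ≤ t') :
    GrowthLE φ ω t' v := fun r hr => h r (ht.trans_lt hr)

theorem GrowthLE.of_forall_pos {t : ℝ} {v : Plane} (h : ∀ d > 0, GrowthLE φ ω (t + d) v) :
    GrowthLE φ ω t v := fun r hr => h ((r - t) / 2) (by linarith) r (by linarith)

theorem growthLE_norm (v : Plane) : GrowthLE φ ω ‖v‖ v := fun r hr => Eventually.of_forall
  fun n => ((invLin (word φ ω n)).le_opNorm v).trans (by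
    rw [mul_comm]; exact mul_le_mul_of_nonneg_right hr.le (norm_nonneg _))

theorem GrowthLE.add {t t' : ℝ} {v w : Plane} (h : GrowthLE φ ω t v) (h' : GrowthLE φ ω t' w) :
    GrowthLE φ ω (t + t') (v + w) := by
  intro r hr
  filter_upwards [h (t + (r - (t + t')) / 2) (by linarith),
    h' (t' + (r - (t + t')) / 2) (by linarith)] with n h1 h2
  rw [map_add]
  refine (norm_add_le _ _).trans ((add_le_add h1 h2).trans (le_of_eq ?_))
  ring

theorem GrowthLE.smul {t : ℝ} (c : ℝ) {v : Plane} (h : GrowthLE φ ω t v) :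
    GrowthLE φ ω (|c| * t) (c • v) := by
  refine GrowthLE.of_forall_pos fun d hd r hr => ?_
  filter_upwards [h (t + d / (|c| + 1)) (by have := abs_nonneg c; simp; positivity)] with n h1
  rw [map_smul, norm_smul, Real.norm_eq_abs]
  have h2 : |c| * (t + d / (|c| + 1)) ≤ r := by
    have h3 : |c| * (d / (|c| + 1)) ≤ d := by
      rw [← mul_div_assoc, div_le_iff₀ (by positivity)]
      nlinarith [abs_nonneg c]
    linarith
  calc |c| * ‖invLin (word φ ω n) v‖ ≤ |c| * ((t + d / (|c| + 1)) * ‖invLin (word φ ω n)‖) := by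
        gcongr
    _ ≤ r * ‖invLin (word φ ω n)‖ := by
        rw [← mul_assoc]
        gcongr

theorem GrowthLE.of_norm_sub_le {t d : ℝ} {v w : Plane} (h : GrowthLE φ ω t v)
    (hd : ‖w - v‖ ≤ d) : GrowthLE φ ω (t + d) w := by
  have := h.add ((growthLE_norm (w - v)).mono hd)
  rwa [add_sub_cancel] at this

variable (φ ω) in
/-- The subspace of the vectors along which the inverse cocycle grows slower than its norm. -/
def slowSpace : Submodule ℝ Plane where
  carrier := {v | GrowthLE φ ω 0 v}
  zero_mem' := by simpa using growthLE_norm (φ := φ) (ω := ω) 0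
  add_mem' h h' := by simpa using GrowthLE.add h h'
  smul_mem' c v h := by simpa using GrowthLE.smul c h

theorem mem_slowSpace {v : Plane} : v ∈ slowSpace φ ω ↔ GrowthLE φ ω 0 v := Iff.rfl

/-- An operator is controlled by its values on a basis, so two basis vectors cannot both be slow. -/
theorem slowSpace_ne_top : slowSpace φ ω ≠ ⊤ := by
  intro h
  have h0 : GrowthLE φ ω 0 (EuclideanSpace.single 0 1) := mem_slowSpace.1 (h ▸ trivial)
  have h1 : GrowthLE φ ω 0 (EuclideanSpace.single 1 1) := mem_slowSpace.1 (h ▸ trivial)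
  -- Two contributions of `1/4` force `‖M‖ ≤ ‖M‖ / 2`.
  obtain ⟨n, hn0, hn1⟩ := ((h0 (1 / 4) (by norm_num)).and (h1 (1 / 4) (by norm_num))).exists
  set M := invLin (word φ ω n)
  have hM : 0 < ‖M‖ := norm_invLin_pos _
  have : ‖M‖ ≤ 1 / 2 * ‖M‖ := by
    refine M.opNorm_le_bound (by positivity) fun v => ?_
    have hv : v = v 0 • EuclideanSpace.single 0 1 + v 1 • EuclideanSpace.single 1 1 := by
      ext i; fin_cases i <;> simp
    have hle : ∀ i, |v i| ≤ ‖v‖ := fun i => PiLp.norm_apply_le v i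
    calc ‖M v‖ = ‖v 0 • M (EuclideanSpace.single 0 1) + v 1 • M (EuclideanSpace.single 1 1)‖ := by
          rw [← map_smul, ← map_smul, ← map_add, ← hv]
      _ ≤ |v 0| * ‖M (EuclideanSpace.single 0 1)‖ + |v 1| * ‖M (EuclideanSpace.single 1 1)‖ := by
          refine (norm_add_le _ _).trans ?_
          rw [norm_smul, norm_smul, Real.norm_eq_abs, Real.norm_eq_abs]
      _ ≤ ‖v‖ * (1 / 4 * ‖M‖) + ‖v‖ * (1 / 4 * ‖M‖) := by
          gcongr
          · exact hle 0
          · exact hle 1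
      _ = _ := by ring
  linarith

/-- The inverse cocycle of the concatenation is that of the tail after the fixed `invLin (word φ ω
n)`, and its norm is submultiplicative, which costs only the constant `‖invLin g‖`. -/
theorem GrowthLE.of_concat {n : ℕ} {η : ℕ → Λ} {v : Plane} (h : GrowthLE φ (concat n ω η) 0 v) :
    GrowthLE φ η 0 (invLin (word φ ω n) v) := by
  intro r hr
  set g := word φ ω n
  have hg : 0 < ‖invLin g‖ := norm_invLin_pos _
  have h1 := (tendsto_add_atTop_nat n).eventually (h (r / ‖invLin g‖) (div_pos hr hg))
  filter_upwards [h1] with k hk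
  rw [add_comm k n, word_concat, invLin_mul] at hk
  refine hk.trans ?_
  calc r / ‖invLin g‖ * ‖(invLin (word φ η k)).comp (invLin g)‖
      ≤ r / ‖invLin g‖ * (‖invLin (word φ η k)‖ * ‖invLin g‖) := by
        gcongr
        exact ContinuousLinearMap.opNorm_comp_le _ _
    _ = _ := by field_simp

variable (φ) in
/-- The words `ω` for which `ψ` maps the point coded by `ω` close to the slow direction. -/
def slowSet (t : ℝ) (ψ : AffVec) : Set (ℕ → Λ) := {ω | GrowthLE φ ω t (ψ (codingMap φ ω))}

theorem slowSet_smul_subset {t : ℝ} (c : ℝ) (ψ : AffVec) :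
    slowSet φ t ψ ⊆ slowSet φ (|c| * t) (c • ψ) := fun _ h => GrowthLE.smul c h

variable [Fintype Λ] [Nonempty Λ] [MeasurableSpace Λ] [DiscreteMeasurableSpace Λ]

/-- Self-similarity of the slow sets, and the reason for the form of `pull`: the prefix acts on the
point by its affine map and on the slow vector by its inverse linear part. -/
theorem mem_slowSet_of_concat (hφ : ∀ i, ∃ K : ℝ≥0, ContractingWith K (φ i)) {n : ℕ}
    {η : ℕ → Λ} {ψ : AffVec} (h : concat n ω η ∈ slowSet φ 0 ψ) :
    η ∈ slowSet φ 0 (pull (word φ ω n) ψ) := by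
  have := GrowthLE.of_concat h
  rwa [codingMap_concat φ hφ] at this

variable (φ) in
theorem measurable_invLin_word (n : ℕ) : Measurable fun ω : ℕ → Λ => invLin (word φ ω n) :=
  measurable_of_prefix n _ fun ω ω' h => by rw [word_congr φ h]

theorem measurable_norm_clm_apply :
    Measurable fun q : (Plane →L[ℝ] Plane) × Plane => ‖q.1 q.2‖ := by
  have : SecondCountableTopology (Plane →L[ℝ] Plane) := secondCountable_of_proper
  have hc : Continuous fun q : (Plane →L[ℝ] Plane) × Plane => ‖q.1 q.2‖ := by fun_prop
  exact hc.measurable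

/-- The parameter space is general because Fubini later needs joint measurability in the maps and
the word. -/
theorem measurableSet_growthLE {X : Type*} [MeasurableSpace X] {f : X → ℕ → Λ} {v : X → Plane}
    (hf : Measurable f) (hv : Measurable v) (t : ℝ) :
    MeasurableSet {x | GrowthLE φ (f x) t (v x)} := by
  have h : {x | GrowthLE φ (f x) t (v x)} = {x | ∀ k : ℕ, ∃ N : ℕ, ∀ n, N ≤ n →
      ‖invLin (word φ (f x) n) (v x)‖ ≤ (t + 1 / ((k : ℝ) + 1)) * ‖invLin (word φ (f x) n)‖} := by
    ext x
    constructor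
    · intro h k
      exact eventually_atTop.1 (h _ (lt_add_of_pos_right _ (by positivity)))
    · intro h r hr
      obtain ⟨k, hk⟩ := exists_nat_one_div_lt (sub_pos.2 hr)
      filter_upwards [eventually_atTop.2 (h k)] with n hn
      refine hn.trans ?_
      gcongr
      linarith
  have hMv : ∀ n, Measurable fun x => ‖invLin (word φ (f x) n) (v x)‖ := fun n => by
    have h1 : Measurable fun x => invLin (word φ (f x) n) := (measurable_invLin_word φ n).comp hf
    have h2 := measurable_norm_clm_apply.comp (h1.prodMk hv)
    exact h2
  have hM : ∀ n, Measurable fun x => ‖invLin (word φ (f x) n)‖ := fun n =>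
    (measurable_of_prefix n (fun ω : ℕ → Λ => ‖invLin (word φ ω n)‖)
      fun ω ω' h => by rw [word_congr φ h]).comp hf
  have hle : ∀ (c : ℝ) (n : ℕ), MeasurableSet {x | ‖invLin (word φ (f x) n) (v x)‖ ≤
      c * ‖invLin (word φ (f x) n)‖} := fun c n => by
    have hMc : Measurable fun x => c * ‖invLin (word φ (f x) n)‖ := measurable_const.mul (hM n)
    exact measurableSet_le (hMv n) hMc
  rw [h]
  simp only [Set.ofPred_forall, Set.ofPred_exists]
  exact MeasurableSet.iInter fun k => MeasurableSet.iUnion fun N => MeasurableSet.iInter fun n =>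
    MeasurableSet.iInter fun _ => hle _ n

theorem measurableSet_slowSet (hφ : ∀ i, ∃ K : ℝ≥0, ContractingWith K (φ i)) (t : ℝ)
    (ψ : AffVec) : MeasurableSet (slowSet φ t ψ) :=
  measurableSet_growthLE measurable_id
    (ψ.continuous.measurable.comp (measurable_codingMap φ hφ)) t

/-- Upper semicontinuity: the unit sphere of affine maps is compact, and a word lying in infinitely
many of the sets of a convergent subsequence lies in the limit set, as the tolerance and the error
of `ψ` both vanish. -/
theorem exists_unit_slowSet_limit (hφ : ∀ i, ∃ K : ℝ≥0, ContractingWith K (φ i)) (p : PMF Λ)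
    {ψ : ℕ → AffVec} {t c : ℕ → ℝ} {c₀ : ℝ} (hψ : ∀ k, ‖ψ k‖ = 1)
    (ht : Tendsto t atTop (𝓝 0)) (hc : Tendsto c atTop (𝓝 c₀))
    (h : ∀ k, c k ≤ (wordMeasure p).real (slowSet φ (t k) (ψ k))) :
    ∃ ψ₀ : AffVec, ‖ψ₀‖ = 1 ∧ c₀ ≤ (wordMeasure p).real (slowSet φ 0 ψ₀) := by
  obtain ⟨C, hC⟩ := exists_codingMap_bound φ hφ
  obtain ⟨ψ₀, hψ₀, σ, hσ, hlim⟩ := (isCompact_sphere (0 : AffVec) 1).tendsto_subseq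
    (x := ψ) fun k => by simpa using hψ k
  refine ⟨ψ₀, by simpa using hψ₀, ?_⟩
  -- These sets decrease to the limsup of the slow sets, each has mass at least `c₀`, and continuity
  -- from above passes this to the limit.
  let U : ℕ → Set (ℕ → Λ) := fun n => ⋃ k ≥ n, slowSet φ (t (σ k)) (ψ (σ k))
  have hUm : ∀ n, MeasurableSet (U n) := fun n => MeasurableSet.iUnion fun k =>
    MeasurableSet.iUnion fun _ => measurableSet_slowSet hφ _ _
  have hanti : Antitone U := fun m n hmn =>
    Set.biUnion_mono (fun k hk => le_trans hmn hk) fun _ _ => subset_rfl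
  have hsub : (⋂ n, U n) ⊆ slowSet φ 0 ψ₀ := by
    intro ω hω
    refine GrowthLE.of_forall_pos fun d hd => ?_
    have h1 : ∀ᶠ k in atTop, t (σ k) < d / 2 :=
      (ht.comp hσ.tendsto_atTop).eventually (gt_mem_nhds (by linarith))
    have h2 : ∀ᶠ k in atTop, ‖ψ₀ (codingMap φ ω) - ψ (σ k) (codingMap φ ω)‖ < d / 2 := by
      have h3 : Tendsto (fun k => ‖ψ₀ (codingMap φ ω) - ψ (σ k) (codingMap φ ω)‖) atTop
          (𝓝 ‖ψ₀ (codingMap φ ω) - ψ₀ (codingMap φ ω)‖) :=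
        (tendsto_const_nhds.sub ((continuous_affVec_apply.tendsto (ψ₀, codingMap φ ω)).comp
          (hlim.prodMk_nhds tendsto_const_nhds))).norm
      rw [sub_self, norm_zero] at h3
      exact h3.eventually (gt_mem_nhds (by linarith))
    obtain ⟨N, hN⟩ := eventually_atTop.1 (h1.and h2)
    obtain ⟨k, hk, hkω⟩ := Set.mem_iUnion₂.1 (Set.mem_iInter.1 hω N)
    have h4 := (GrowthLE.of_norm_sub_le hkω (hN k hk).2.le).mono
      (show t (σ k) + d / 2 ≤ 0 + d by linarith [(hN k hk).1])
    exact h4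
  have hU : ∀ n, ENNReal.ofReal c₀ ≤ wordMeasure p (U n) := by
    intro n
    refine ENNReal.ofReal_le_of_le_toReal ?_
    refine le_of_tendsto (hc.comp hσ.tendsto_atTop) (eventually_atTop.2 ⟨n, fun k hk => ?_⟩)
    exact (h (σ k)).trans (measureReal_mono (h₂ := measure_ne_top _ _)
      (Set.subset_biUnion_of_mem (u := fun k => slowSet φ (t (σ k)) (ψ (σ k)))
        (show k ∈ {k | n ≤ k} from hk)))
  have hlimU := tendsto_measure_iInter_atTop (μ := wordMeasure p)
    (fun n => (hUm n).nullMeasurableSet) hanti ⟨0, measure_ne_top _ _⟩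
  have h5 : ENNReal.ofReal c₀ ≤ wordMeasure p (slowSet φ 0 ψ₀) :=
    (ge_of_tendsto' hlimU hU).trans (measure_mono hsub)
  exact (ENNReal.ofReal_le_iff_le_toReal (measure_ne_top _ _)).1 h5

end Growth

/-! ### Plane geometry -/

section Geometry

/-- The rotation by a right angle. -/
noncomputable def rot (x : Plane) : Plane := !₂[-x 1, x 0]

theorem inner_plane (x y : Plane) : inner ℝ x y = x 0 * y 0 + x 1 * y 1 := by
  simp [PiLp.inner_apply, Fin.sum_univ_two, mul_comm]

theorem norm_sq_plane (x : Plane) : ‖x‖ ^ 2 = x 0 ^ 2 + x 1 ^ 2 := by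
  rw [EuclideanSpace.norm_sq_eq]
  simp [Fin.sum_univ_two]

theorem norm_sq_plane_pos {x : Plane} (hx : x ≠ 0) : 0 < x 0 ^ 2 + x 1 ^ 2 := by
  rw [← norm_sq_plane]
  exact pow_pos (norm_pos_iff.2 hx) 2

theorem rot_ne_zero {x : Plane} (hx : x ≠ 0) : rot x ≠ 0 := by
  intro h
  refine hx ?_
  have h0 := congrArg (fun v : Plane => v 0) h
  have h1 := congrArg (fun v : Plane => v 1) h
  simp [rot] at h0 h1
  ext i
  fin_cases i <;> simp [h0, h1]

theorem exists_eq_smul_rot {x y : Plane} (hx : x ≠ 0) (h : inner ℝ x y = 0) :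
    ∃ c : ℝ, y = c • rot x := by
  have hpos := norm_sq_plane_pos hx
  rw [inner_plane] at h
  refine ⟨(x 0 * y 1 - x 1 * y 0) / (x 0 ^ 2 + x 1 ^ 2), ?_⟩
  ext i
  fin_cases i
  · simp [rot]
    field_simp
    linear_combination x 0 * h
  · simp [rot]
    field_simp
    linear_combination x 1 * h

theorem exists_eq_add_smul_rot {x : Plane} (hx : x ≠ 0) (y : Plane) :
    ∃ s t : ℝ, y = s • x + t • rot x := by
  have hpos := norm_sq_plane_pos hx
  refine ⟨(x 0 * y 0 + x 1 * y 1) / (x 0 ^ 2 + x 1 ^ 2),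
    (x 0 * y 1 - x 1 * y 0) / (x 0 ^ 2 + x 1 ^ 2), ?_⟩
  ext i
  fin_cases i
  · simp [rot]
    field_simp
    ring
  · simp [rot]
    field_simp
    ring

theorem rot_add_smul (s t : ℝ) (x y : Plane) : rot (s • x + t • y) = s • rot x + t • rot y := by
  ext i
  fin_cases i
  · simp [rot]
    ring
  · simp [rot]

theorem rot_smul (s : ℝ) (x : Plane) : rot (s • x) = s • rot x := by
  ext i
  fin_cases i <;> simp [rot]

theorem rot_rot (x : Plane) : rot (rot x) = -x := by
  ext i
  fin_cases i <;> simp [rot]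

theorem norm_rot (x : Plane) : ‖rot x‖ = ‖x‖ := by
  have h : ‖rot x‖ ^ 2 = ‖x‖ ^ 2 := by
    rw [norm_sq_plane, norm_sq_plane]
    simp [rot]
    ring
  exact (pow_left_inj₀ (norm_nonneg _) (norm_nonneg _) two_ne_zero).1 h

theorem inner_rot_self (x : Plane) : inner ℝ x (rot x) = 0 := by
  rw [inner_plane]
  simp [rot]
  ring

/-- The linear part of an affine automorphism. -/
noncomputable def lin (g : Plane ≃ᵃ[ℝ] Plane) : Plane →L[ℝ] Plane :=
  LinearMap.toContinuousLinearMap (g.linear : Plane →ₗ[ℝ] Plane)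

theorem invLin_lin (g : Plane ≃ᵃ[ℝ] Plane) (v : Plane) : invLin g (lin g v) = v :=
  g.linear.symm_apply_apply v

theorem lin_invLin (g : Plane ≃ᵃ[ℝ] Plane) (v : Plane) : lin g (invLin g v) = v :=
  g.linear.apply_symm_apply v

theorem affine_sub (g : Plane ≃ᵃ[ℝ] Plane) (x y : Plane) : g x - g y = lin g (x - y) :=
  ((g : Plane →ᵃ[ℝ] Plane).linearMap_vsub x y).symm

theorem norm_lin_pos (g : Plane ≃ᵃ[ℝ] Plane) : 0 < ‖lin g‖ := by
  rw [norm_pos_iff]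
  intro h
  obtain ⟨v, hv⟩ := exists_ne (0 : Plane)
  have := lin_invLin g v
  rw [h] at this
  exact hv this.symm

theorem exists_lin_eq_smul {g : Plane ≃ᵃ[ℝ] Plane} {v w : Plane} {c : ℝ} (hv : v ≠ 0)
    (h : invLin g v = c • w) : ∃ c' : ℝ, lin g w = c' • v := by
  have hc : c ≠ 0 := by
    rintro rfl
    rw [zero_smul, invLin_eq_zero_iff] at h
    exact hv h
  refine ⟨c⁻¹, ?_⟩
  have := lin_invLin g v
  rw [h, map_smul] at this
  rw [← this, smul_smul, inv_mul_cancel₀ hc, one_smul]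

theorem TotallyIrreducible.false_of_vectors {Λ : Type*} {φ : Λ → Plane ≃ᵃ[ℝ] Plane}
    (h : TotallyIrreducible φ) {F : Set Plane} (hfin : F.Finite) (hne : F.Nonempty)
    (h0 : ∀ v ∈ F, v ≠ 0) (hF : ∀ i, ∀ v ∈ F, ∃ w ∈ F, ∃ c : ℝ, lin (φ i) v = c • w) : False := by
  refine h ⟨⋃ v ∈ F, {ℓ | ∃ hv : v ≠ 0, ℓ = Projectivization.mk ℝ v hv}, ?_, ?_, ?_⟩
  · refine hfin.biUnion fun v _ => Set.Subsingleton.finite ?_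
    rintro _ ⟨_, rfl⟩ _ ⟨_, rfl⟩
    rfl
  · obtain ⟨v, hv⟩ := hne
    exact ⟨Projectivization.mk ℝ v (h0 v hv), Set.mem_biUnion hv ⟨h0 v hv, rfl⟩⟩
  · intro i ℓ hℓ
    obtain ⟨v, hv, hv0, rfl⟩ := Set.mem_iUnion₂.1 hℓ
    obtain ⟨w, hw, c, hc⟩ := hF i v hv
    refine ⟨Projectivization.mk ℝ w (h0 w hw), Set.mem_biUnion hw ⟨h0 w hw, rfl⟩, ?_⟩
    have hc0 : c ≠ 0 := by
      rintro rfl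
      rw [zero_smul] at hc
      have := invLin_lin (φ i) v
      rw [hc, map_zero] at this
      exact hv0 this.symm
    rw [Projectivization.submodule_mk, Projectivization.submodule_mk, Submodule.map_span,
      Set.image_singleton]
    change _ = Submodule.span ℝ {lin (φ i) v}
    rw [hc, Submodule.span_singleton_smul_eq (IsUnit.mk0 c hc0)]

theorem NonConformal.false_of_norm {Λ : Type*} {φ : Λ → Plane ≃ᵃ[ℝ] Plane}
    (h : NonConformal φ) (hφ : ∀ i, ∃ r : ℝ, ∀ v, ‖lin (φ i) v‖ = r * ‖v‖) : False := by
  refine h ⟨AffineEquiv.refl ℝ Plane, fun i => ?_⟩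
  obtain ⟨r, hr⟩ := hφ i
  refine ⟨r, fun x y => ?_⟩
  change dist (φ i x) (φ i y) = _
  rw [dist_eq_norm, dist_eq_norm, affine_sub, hr]

/-- A nonzero vector whose pair with its rotation stays orthogonal under the inverses of the words
cannot exist for a non-conformal totally irreducible system. -/
theorem false_of_orthogonal {Λ : Type*} {φ : Λ → Plane ≃ᵃ[ℝ] Plane}
    (hnc : NonConformal φ) (hirr : TotallyIrreducible φ) {P : Plane} (hP : P ≠ 0)
    (h : ∀ (η : ℕ → Λ) (j : ℕ),
      inner ℝ (invLin (word φ η j) P) (invLin (word φ η j) (rot P)) = 0) : False := by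
  have hword : ∀ (i : Λ) (η : ℕ → Λ) (j : ℕ) (v : Plane),
      invLin (word φ (concat 1 (fun _ => i) η) (1 + j)) v =
        invLin (word φ η j) (invLin (φ i) v) := by
    intro i η j v
    rw [word_concat, word_one, invLin_mul]
    rfl
  have hone : ∀ (i : Λ) (v : Plane), invLin (word φ (fun _ => i) 1) v = invLin (φ i) v := by
    intro i v
    rw [word_one]
  have hrot : ∀ i, ∃ c : ℝ, c ≠ 0 ∧ invLin (φ i) (rot P) = c • rot (invLin (φ i) P) := by
    intro i
    have h1 := h (fun _ => i) 1
    rw [hone, hone] at h1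
    obtain ⟨c, hc⟩ := exists_eq_smul_rot (fun h0 => hP ((invLin_eq_zero_iff _ _).1 h0)) h1
    refine ⟨c, ?_, hc⟩
    rintro rfl
    rw [zero_smul, invLin_eq_zero_iff] at hc
    exact rot_ne_zero hP hc
  -- Either every inverse linear part permutes the lines of `P` and `rot P`, an invariant finite set
  -- of lines, or some letter sends `P` to a generic direction.
  by_cases hcase : ∀ i, (∃ c : ℝ, invLin (φ i) P = c • P) ∨ ∃ c : ℝ, invLin (φ i) P = c • rot P
  · refine hirr.false_of_vectors (F := {P, rot P}) (by simp) ⟨P, by simp⟩ ?_ ?_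
    · rintro v (rfl | rfl)
      · exact hP
      · exact rot_ne_zero hP
    · intro i v hv
      obtain ⟨d, -, hd⟩ := hrot i
      rcases hcase i with ⟨c, hc⟩ | ⟨c, hc⟩
      · rw [hc, rot_smul, smul_smul] at hd
        rcases hv with rfl | rfl
        · exact ⟨_, by simp, exists_lin_eq_smul hP hc⟩
        · exact ⟨_, by simp, exists_lin_eq_smul (rot_ne_zero hP) hd⟩
      · rw [hc, rot_smul, rot_rot, smul_neg, smul_neg, smul_smul, ← neg_smul] at hd
        rcases hv with rfl | rfl
        · exact ⟨_, by simp, exists_lin_eq_smul (rot_ne_zero hP) hd⟩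
        · exact ⟨_, by simp, exists_lin_eq_smul hP hc⟩
  · push Not at hcase
    obtain ⟨i, hi1, hi2⟩ := hcase
    obtain ⟨s, t, hst⟩ := exists_eq_add_smul_rot hP (invLin (φ i) P)
    have hs : s ≠ 0 := by
      rintro rfl
      exact hi2 t (by rw [hst]; simp)
    have ht : t ≠ 0 := by
      rintro rfl
      exact hi1 s (by rw [hst]; simp)
    refine hnc.false_of_norm fun j => ?_
    set X := invLin (φ j)
    have h1 : inner ℝ (X P) (X (rot P)) = 0 := by simpa only [hone] using h (fun _ => j) 1
    -- The word `i` followed by `j` gives a second orthogonal pair, in general position to the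
    -- first. A linear map keeping both pairs orthogonal is a similarity.
    have h2 : inner ℝ (X (s • P + t • rot P)) (X (s • rot P - t • P)) = 0 := by
      have h3 := h (concat 1 (fun _ => i) (fun _ => j)) (1 + 1)
      obtain ⟨c, hc, hc'⟩ := hrot i
      rw [hword, hword, hone, hone, hc', map_smul, inner_smul_right, hst, rot_add_smul, rot_rot,
        smul_neg, ← sub_eq_add_neg] at h3
      exact (mul_eq_zero.1 h3).resolve_left hc
    have hnorm : ‖X (rot P)‖ ^ 2 = ‖X P‖ ^ 2 := by
      simp only [map_add, map_sub, map_smul, inner_add_left, inner_sub_right, inner_smul_left,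
        inner_smul_right, real_inner_self_eq_norm_sq, h1, real_inner_comm (X P) (X (rot P)),
        RCLike.conj_to_real] at h2
      have h4 : s * t * (‖X (rot P)‖ ^ 2 - ‖X P‖ ^ 2) = 0 := by linear_combination h2
      have := (mul_eq_zero.1 h4).resolve_left (mul_ne_zero hs ht)
      linarith
    have hXP : 0 < ‖X P‖ := norm_pos_iff.2 fun h0 => hP ((invLin_eq_zero_iff _ _).1 h0)
    have hPn : 0 < ‖P‖ := norm_pos_iff.2 hP
    have hsim : ∀ x, ‖X x‖ = ‖X P‖ / ‖P‖ * ‖x‖ := by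
      intro x
      obtain ⟨a, b, rfl⟩ := exists_eq_add_smul_rot hP x
      have e1 : ‖X (a • P + b • rot P)‖ ^ 2 = (a ^ 2 + b ^ 2) * ‖X P‖ ^ 2 := by
        rw [map_add, map_smul, map_smul, norm_add_sq_real, inner_smul_left, inner_smul_right, h1,
          norm_smul, norm_smul, mul_pow, mul_pow, hnorm, Real.norm_eq_abs, Real.norm_eq_abs,
          sq_abs, sq_abs]
        ring
      have e2 : ‖a • P + b • rot P‖ ^ 2 = (a ^ 2 + b ^ 2) * ‖P‖ ^ 2 := by
        rw [norm_add_sq_real, inner_smul_left, inner_smul_right, inner_rot_self,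
          norm_smul, norm_smul, mul_pow, mul_pow, norm_rot, Real.norm_eq_abs, Real.norm_eq_abs,
          sq_abs, sq_abs]
        ring
      refine (pow_left_inj₀ (norm_nonneg _) (by positivity) two_ne_zero).1 ?_
      rw [e1, mul_pow, e2, div_pow]
      field_simp
    refine ⟨‖P‖ / ‖X P‖, fun v => ?_⟩
    have h5 := hsim (lin (φ j) v)
    rw [show X (lin (φ j) v) = v from invLin_lin _ _] at h5
    rw [h5]
    field_simp

end Geometry

/-! ### Major axes -/

section MajorAxes

/-- The isometries returned are the inverses of those in the singular value decomposition, so that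
the inverse map becomes diagonal with entries `1 / a` and `1 / b`; invertibility gives `0 < b`. -/
theorem IsMajorAxis.exists_invLin_eq {g : Plane ≃ᵃ[ℝ] Plane} {ℓ : RP1}
    (h : IsMajorAxis (g.linear : Plane →ₗ[ℝ] Plane) ℓ) :
    ∃ (V U : Plane ≃ₗᵢ[ℝ] Plane) (a b : ℝ), 0 < b ∧ b < a ∧ ‖lin g‖ = a ∧
      (∀ x, invLin g x = U !₂[(V x) 0 / a, (V x) 1 / b]) ∧
      ∀ x, x ∈ ℓ.submodule ↔ (V x) 1 = 0 := by
  obtain ⟨V, U, a, b, hb, hab, hA, hℓ⟩ := h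
  have hA' : ∀ x, lin g x = V !₂[a * U x 0, b * U x 1] := hA
  have ha : 0 < a := hb.trans_lt hab
  have hb0 : 0 < b := by
    refine lt_of_le_of_ne hb ?_
    rintro rfl
    have h1 := hA' (U.symm !₂[0, 1])
    have h2 : lin g (U.symm !₂[0, 1]) = 0 := by
      rw [h1]
      have : (!₂[a * U (U.symm !₂[0, 1]) 0, 0 * U (U.symm !₂[0, 1]) 1] : Plane) = 0 := by
        ext i
        fin_cases i <;> simp
      rw [this, map_zero]
    have h3 := invLin_lin g (U.symm !₂[0, 1])
    rw [h2, map_zero] at h3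
    have h4 := congrArg (fun v => (U v) 1) h3
    simp at h4
  refine ⟨V.symm, U.symm, a, b, hb0, hab, ?_, ?_, ?_⟩
  · refine le_antisymm ((lin g).opNorm_le_bound ha.le fun x => ?_) ?_
    · rw [hA', LinearIsometryEquiv.norm_map, ← U.norm_map x]
      refine (pow_le_pow_iff_left₀ (norm_nonneg _) (by positivity) two_ne_zero).1 ?_
      rw [mul_pow, norm_sq_plane, norm_sq_plane]
      simp only [Matrix.cons_val_zero, Matrix.cons_val_one]
      have : b ^ 2 ≤ a ^ 2 := by gcongr
      nlinarith [sq_nonneg (U x 1)]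
    · have h1 := (lin g).le_opNorm (U.symm !₂[1, 0])
      rw [hA', LinearIsometryEquiv.norm_map, LinearIsometryEquiv.norm_map] at h1
      have e1 : ‖(!₂[1, 0] : Plane)‖ = 1 := by
        simp [EuclideanSpace.norm_eq]
      have e2 : (!₂[a * U (U.symm !₂[1, 0]) 0, b * U (U.symm !₂[1, 0]) 1] : Plane) =
          a • !₂[1, 0] := by
        ext i
        fin_cases i <;> simp
      rw [e2, norm_smul, e1, Real.norm_of_nonneg ha.le] at h1
      linarith
  · intro x
    have h1 : lin g (U.symm !₂[(V.symm x) 0 / a, (V.symm x) 1 / b]) = x := by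
      rw [hA']
      have : (!₂[a * U (U.symm !₂[(V.symm x) 0 / a, (V.symm x) 1 / b]) 0,
          b * U (U.symm !₂[(V.symm x) 0 / a, (V.symm x) 1 / b]) 1] : Plane) = V.symm x := by
        ext i
        fin_cases i
        · simp
          field_simp
        · simp
          field_simp
      rw [this, LinearIsometryEquiv.apply_symm_apply]
    conv_lhs => rw [← h1]
    rw [invLin_lin]
  · intro x
    rw [hℓ, Submodule.mem_span_singleton]
    constructor
    · rintro ⟨c, rfl⟩
      simp
    · intro h1
      refine ⟨(V.symm x) 0, ?_⟩
      rw [← map_smul, ← V.apply_symm_apply x, V.symm_apply_apply]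
      congr 1
      ext i
      fin_cases i
      · simp
      · simp [h1]

/-- The inverse contracts by exactly `1 / ‖lin g‖` along the major axis and by strictly less
elsewhere. This describes the axis without a decomposition, hence its uniqueness. -/
theorem IsMajorAxis.mem_iff {g : Plane ≃ᵃ[ℝ] Plane} {ℓ : RP1}
    (h : IsMajorAxis (g.linear : Plane →ₗ[ℝ] Plane) ℓ) (x : Plane) :
    x ∈ ℓ.submodule ↔ ‖invLin g x‖ * ‖lin g‖ ≤ ‖x‖ := by
  obtain ⟨V, U, a, b, hb, hab, ha, hN, hℓ⟩ := h.exists_invLin_eq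
  have ha0 : 0 < a := hb.trans hab
  rw [hℓ, hN, ha, LinearIsometryEquiv.norm_map, ← V.norm_map x,
    ← pow_le_pow_iff_left₀ (by positivity) (norm_nonneg _) two_ne_zero, mul_pow, norm_sq_plane,
    norm_sq_plane]
  simp only [Matrix.cons_val_zero, Matrix.cons_val_one]
  have e : ((V x 0 / a) ^ 2 + (V x 1 / b) ^ 2) * a ^ 2 =
      V x 0 ^ 2 + V x 1 ^ 2 * (a ^ 2 / b ^ 2) := by
    field_simp
  rw [e]
  have h1 : 1 < a ^ 2 / b ^ 2 := by
    rw [one_lt_div (by positivity)]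
    gcongr
  constructor
  · intro h0
    simp [h0]
  · intro h0
    have : V x 1 ^ 2 * (a ^ 2 / b ^ 2 - 1) ≤ 0 := by linarith
    have h2 : V x 1 ^ 2 ≤ 0 := by
      by_contra hc
      push Not at hc
      nlinarith
    exact pow_eq_zero_iff two_ne_zero |>.1 (le_antisymm h2 (sq_nonneg _))

theorem IsMajorAxis.unique {g : Plane ≃ᵃ[ℝ] Plane} {ℓ ℓ' : RP1}
    (h : IsMajorAxis (g.linear : Plane →ₗ[ℝ] Plane) ℓ)
    (h' : IsMajorAxis (g.linear : Plane →ₗ[ℝ] Plane) ℓ') : ℓ = ℓ' := by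
  refine Projectivization.submodule_injective (Submodule.ext fun x => ?_)
  rw [h.mem_iff, h'.mem_iff]

/-- The singular directions are orthogonal both before and after applying the map. -/
theorem IsMajorAxis.inner_invLin {g : Plane ≃ᵃ[ℝ] Plane} {ℓ : RP1}
    (h : IsMajorAxis (g.linear : Plane →ₗ[ℝ] Plane) ℓ) (x y : Plane) :
    inner ℝ (invLin g (ℓ.submodule.starProjection x))
      (invLin g (y - ℓ.submodule.starProjection y)) = 0 := by
  obtain ⟨V, U, a, b, hb, hab, ha, hN, hℓ⟩ := h.exists_invLin_eq
  have h1 : (V (ℓ.submodule.starProjection x)) 1 = 0 :=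
    (hℓ _).1 (Submodule.starProjection_apply_mem _ _)
  have h2 : (V (y - ℓ.submodule.starProjection y)) 0 = 0 := by
    have h3 : V.symm !₂[1, 0] ∈ ℓ.submodule := (hℓ _).2 (by simp)
    have h4 := Submodule.starProjection_inner_eq_zero (K := ℓ.submodule) y _ h3
    rw [← V.inner_map_map, LinearIsometryEquiv.apply_symm_apply, inner_plane] at h4
    simpa using h4
  rw [hN, hN, LinearIsometryEquiv.inner_map_map, inner_plane, h1, h2]
  simp

end MajorAxes

/-! ### Word directions are slow directions -/

section Directions

variable {Λ : Type*} [Fintype Λ] [Nonempty Λ] [MeasurableSpace Λ] [DiscreteMeasurableSpace Λ]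
  {φ : Λ → Plane ≃ᵃ[ℝ] Plane}

theorem distRP1_comm (V W : RP1) : distRP1 V W = distRP1 W V := norm_sub_rev _ _

theorem distRP1_triangle (U V W : RP1) : distRP1 U W ≤ distRP1 U V + distRP1 V W :=
  norm_sub_le_norm_sub_add_norm_sub _ _ _

/-- If with positive probability the direction exists although the condition numbers of the
prefixes have a bounded subsequence, then there are well-conditioned words whose major axis hardly
moves under all short continuations. -/
theorem exists_stable_word (p : PMF Λ) (hp : ∀ i, 0 < p i) {R : ℝ}
    (hpos : ¬ ∀ᵐ ω ∂(wordMeasure p), ¬ ((∃ V, IsWordDirection φ ω V) ∧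
      ∃ᶠ n in atTop, ‖lin (word φ ω n)‖ * ‖invLin (word φ ω n)‖ ≤ R))
    {ε : ℝ} (hε : 0 < ε) (k : ℕ) :
    ∃ (g : Plane ≃ᵃ[ℝ] Plane) (ℓ : RP1), ‖lin g‖ * ‖invLin g‖ ≤ R ∧
      IsMajorAxis (g.linear : Plane →ₗ[ℝ] Plane) ℓ ∧ ∀ (η : ℕ → Λ), ∀ j ≤ k, ∃ ℓ' : RP1,
        IsMajorAxis ((g * word φ η j).linear : Plane →ₗ[ℝ] Plane) ℓ' ∧ distRP1 ℓ ℓ' ≤ ε := by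
  -- The existence of a limit direction is replaced by a Cauchy condition on the axes, built from
  -- events that depend on finitely many letters and are therefore measurable.
  let T : ℕ → ℕ → Set (ℕ → Λ) := fun n n' => {ω | ∃ ℓ ℓ' : RP1,
    IsMajorAxis ((word φ ω n).linear : Plane →ₗ[ℝ] Plane) ℓ ∧
    IsMajorAxis ((word φ ω n').linear : Plane →ₗ[ℝ] Plane) ℓ' ∧ distRP1 ℓ ℓ' ≤ ε}
  let B : ℕ → Set (ℕ → Λ) := fun n => {ω | ‖lin (word φ ω n)‖ * ‖invLin (word φ ω n)‖ ≤ R}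
  let E : ℕ → Set (ℕ → Λ) := fun m =>
    (⋂ n ≥ m, ⋂ n' ≥ m, T n n') ∩ ⋂ N : ℕ, ⋃ n ≥ N, B n
  have hprefix : ∀ (n : ℕ) (Q : (ℕ → Λ) → Prop),
      (∀ ω ω' : ℕ → Λ, (∀ k < n, ω k = ω' k) → Q ω = Q ω') → MeasurableSet {ω | Q ω} :=
    fun n Q hQ => measurableSet_setOfPred.2 (measurable_of_prefix n Q hQ)
  have hT : ∀ n n', MeasurableSet (T n n') := by
    intro n n'
    refine hprefix (max n n') _ fun ω ω' h => ?_
    rw [word_congr φ (n := n) fun k hk => h k (lt_max_of_lt_left hk),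
      word_congr φ (n := n') fun k hk => h k (lt_max_of_lt_right hk)]
  have hB : ∀ n, MeasurableSet (B n) := fun n => hprefix n _ fun ω ω' h => by rw [word_congr φ h]
  have hE : ∀ m, MeasurableSet (E m) := fun m =>
    (MeasurableSet.iInter fun n => MeasurableSet.iInter fun _ => MeasurableSet.iInter fun n' =>
      MeasurableSet.iInter fun _ => hT n n').inter
    (MeasurableSet.iInter fun N => MeasurableSet.iUnion fun n => MeasurableSet.iUnion fun _ => hB n)
  have hcover : ∀ ω, ((∃ V, IsWordDirection φ ω V) ∧
      ∃ᶠ n in atTop, ‖lin (word φ ω n)‖ * ‖invLin (word φ ω n)‖ ≤ R) → ∃ m, ω ∈ E m := by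
    rintro ω ⟨⟨V, ℓ, hℓ, hlim⟩, hR⟩
    obtain ⟨m, hm⟩ := eventually_atTop.1 (hℓ.and
      (hlim.eventually (gt_mem_nhds (show 0 < ε / 2 by linarith))))
    refine ⟨m, Set.mem_inter ?_ ?_⟩
    · refine Set.mem_iInter₂.2 fun n hn => Set.mem_iInter₂.2 fun n' hn' => ?_
      refine ⟨ℓ n, ℓ n', (hm n hn).1, (hm n' hn').1, ?_⟩
      have := distRP1_triangle (ℓ n) V (ℓ n')
      rw [distRP1_comm V] at this
      linarith [(hm n hn).2, (hm n' hn').2]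
    · refine Set.mem_iInter.2 fun N => ?_
      obtain ⟨n, hn, hnR⟩ := frequently_atTop.1 hR N
      exact Set.mem_biUnion (show n ∈ {n | n ≥ N} from hn) hnR
  obtain ⟨c, hc, hcyl⟩ := exists_pos_le_measureReal_cylinder p hp k
  have hex : ∃ m ω, ω ∈ E m ∧ Tendsto
      (fun n => (wordMeasure p).real {η | concat n ω η ∈ E m}) atTop (𝓝 1) := by
    by_contra hcon
    push Not at hcon
    refine hpos ?_
    filter_upwards [ae_all_iff.2 fun m => tendsto_measureReal_concat p (hE m)] with ω hω hω'
    obtain ⟨m, hm⟩ := hcover ω hω'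
    have := hω m
    rw [Set.indicator_of_mem hm] at this
    exact hcon m ω hm this
  obtain ⟨m, ω, hω, hlim⟩ := hex
  obtain ⟨N, hN⟩ := eventually_atTop.1 (hlim.eventually (lt_mem_nhds (sub_lt_self 1 hc)))
  obtain ⟨n, hn, hnR⟩ := Set.mem_iUnion₂.1 (Set.mem_iInter.1 hω.2 (max N m))
  have hnN : N ≤ n := (le_max_left _ _).trans hn
  have hnm : m ≤ n := (le_max_right _ _).trans hn
  obtain ⟨ℓ, -, hℓ, -, -⟩ := Set.mem_iInter₂.1 (Set.mem_iInter₂.1 hω.1 n hnm) n hnm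
  refine ⟨word φ ω n, ℓ, hnR, hℓ, fun η₀ j hj => ?_⟩
  -- The bad tails have mass less than `c`, while every cylinder of length `k` has mass at least
  -- `c`; so each continuation of length `k` begins some good tail.
  obtain ⟨η, hη, hηc⟩ : ({η | concat n ω η ∈ E m} ∩ {η | ∀ i < k, η i = η₀ i}).Nonempty := by
    by_contra hemp
    have hdisj := Set.disjoint_iff_inter_eq_empty.2 (Set.not_nonempty_iff_eq_empty.1 hemp)
    have h1 := measureReal_union (μ := wordMeasure p) hdisj.symm
      (measurableSet_concat_preimage n ω (hE m))
    have h2 : (wordMeasure p).real ({η | ∀ i < k, η i = η₀ i} ∪ {η | concat n ω η ∈ E m}) ≤ 1 :=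
      measureReal_le_one
    linarith [hN n hnN, hcyl η₀]
  obtain ⟨ℓ₁, ℓ', h1, h2, h3⟩ := Set.mem_iInter₂.1 (Set.mem_iInter₂.1 hη.1 n hnm) (n + j)
    (hnm.trans (Nat.le_add_right _ _))
  rw [word_congr φ (ω' := ω) fun i hi => concat_of_lt ω η hi] at h1
  rw [word_concat, word_congr φ (n := j) fun i hi => hηc i (hi.trans_le hj)] at h2
  exact ⟨ℓ', h2, h1.unique hℓ ▸ h3⟩

/-- Replacing the projection to `ℓ` by that to the true axis `ℓ'` makes the images exactly
orthogonal; each of the two replacements costs `ε * ‖invLin g‖ ^ 2`. -/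
theorem inner_invLin_le_of_distRP1_le {g : Plane ≃ᵃ[ℝ] Plane} {ℓ ℓ' : RP1} {ε : ℝ}
    (h : IsMajorAxis (g.linear : Plane →ₗ[ℝ] Plane) ℓ') (hd : distRP1 ℓ ℓ' ≤ ε) {x y : Plane}
    (hx : ‖x‖ = 1) (hy : ‖y‖ = 1) (hxℓ : ℓ.submodule.starProjection x = x)
    (hyℓ : ℓ.submodule.starProjection y = 0) :
    |inner ℝ (invLin g x) (invLin g y)| ≤ 2 * ε * ‖invLin g‖ ^ 2 := by
  set π := ℓ.submodule.starProjection
  set π' := ℓ'.submodule.starProjection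
  set X := invLin g
  have hε : 0 ≤ ε := (norm_nonneg _).trans hd
  have hπ : ∀ v, ‖v‖ = 1 → ‖π v - π' v‖ ≤ ε := by
    intro v hv
    have := (π - π').le_opNorm v
    rw [hv, mul_one] at this
    exact this.trans hd
  have hX : ∀ v r, ‖v‖ ≤ r → ‖X v‖ ≤ ‖X‖ * r := fun v r hv =>
    (X.le_opNorm v).trans (by gcongr)
  have h0 : inner ℝ (X (π' x)) (X (y - π' y)) = 0 := h.inner_invLin x y
  have e : inner ℝ (X x) (X y) = inner ℝ (X (π x - π' x)) (X y) +
      inner ℝ (X (π' x)) (X (π' y - π y)) := by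
    rw [hxℓ, hyℓ, sub_zero, map_sub, inner_sub_left]
    rw [map_sub, inner_sub_right] at h0
    linarith
  have hπ'x : ‖π' x‖ ≤ 1 := by
    rw [← hx]
    exact Submodule.norm_starProjection_apply_le _ _
  rw [e]
  refine (abs_add_le _ _).trans ?_
  have h1 := (abs_real_inner_le_norm (X (π x - π' x)) (X y)).trans
    (mul_le_mul (hX _ _ (hπ x hx)) (hX _ _ hy.le) (norm_nonneg _) (by positivity))
  have h2 := (abs_real_inner_le_norm (X (π' x)) (X (π' y - π y))).trans
    (mul_le_mul (hX _ _ hπ'x) (hX _ ε ((norm_sub_rev _ _).trans_le (hπ y hy))) (norm_nonneg _)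
      (by positivity))
  linarith

theorem ae_condition_number_unbounded (p : PMF Λ) (hp : ∀ i, 0 < p i) (hnc : NonConformal φ)
    (hirr : TotallyIrreducible φ) (R : ℝ) :
    ∀ᵐ ω ∂(wordMeasure p), ¬ ((∃ V, IsWordDirection φ ω V) ∧
      ∃ᶠ n in atTop, ‖lin (word φ ω n)‖ * ‖invLin (word φ ω n)‖ ≤ R) := by
  by_contra hpos
  -- `P` and `Q` are the normalized images under `invLin g` of unit vectors along and across the
  -- axis of a stable word `g`. The condition number bound `R` keeps them away from zero in the
  -- limit.
  have hstep : ∀ k : ℕ, ∃ P Q : Plane, ‖P‖ ≤ 1 ∧ ‖Q‖ ≤ 1 ∧ 1 ≤ R * ‖P‖ ∧ 1 ≤ R * ‖Q‖ ∧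
      ∀ (η : ℕ → Λ), ∀ j ≤ k, |inner ℝ (invLin (word φ η j) P) (invLin (word φ η j) Q)| ≤
        2 * (1 / ((k : ℝ) + 1)) * ‖invLin (word φ η j)‖ ^ 2 := by
    intro k
    obtain ⟨g, ℓ, hR, hℓ, hall⟩ := exists_stable_word p hp hpos
      (show (0 : ℝ) < 1 / ((k : ℝ) + 1) by positivity) k
    have hN : 0 < ‖invLin g‖ := norm_invLin_pos g
    have hscale : ∀ x : Plane, ‖x‖ = 1 → ‖‖invLin g‖⁻¹ • invLin g x‖ ≤ 1 ∧
        1 ≤ R * ‖‖invLin g‖⁻¹ • invLin g x‖ := by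
      intro x hx
      rw [norm_smul, norm_inv, norm_norm]
      constructor
      · rw [inv_mul_le_iff₀ hN, mul_one]
        simpa [hx] using (invLin g).le_opNorm x
      · have h1 : 1 ≤ ‖lin g‖ * ‖invLin g x‖ := by
          have := (lin g).le_opNorm (invLin g x)
          rwa [lin_invLin, hx] at this
        calc (1 : ℝ) ≤ ‖lin g‖ * ‖invLin g x‖ := h1
          _ = (‖lin g‖ * ‖invLin g‖) * (‖invLin g‖⁻¹ * ‖invLin g x‖) := by field_simp
          _ ≤ R * (‖invLin g‖⁻¹ * ‖invLin g x‖) := by gcongr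
    obtain ⟨x, hxℓ, hx⟩ : ∃ x ∈ ℓ.submodule, ‖x‖ = 1 := by
      refine ⟨‖ℓ.rep‖⁻¹ • ℓ.rep, Submodule.smul_mem _ _ ?_, ?_⟩
      · rw [Projectivization.submodule_eq]
        exact Submodule.mem_span_singleton_self _
      · rw [norm_smul, norm_inv, norm_norm, inv_mul_cancel₀ (norm_ne_zero_iff.2 ℓ.rep_nonzero)]
    have hx0 : x ≠ 0 := norm_ne_zero_iff.1 (by rw [hx]; exact one_ne_zero)
    have hspan : ℓ.submodule = Submodule.span ℝ {x} := by
      rw [Projectivization.submodule_eq]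
      rw [Projectivization.submodule_eq, Submodule.mem_span_singleton] at hxℓ
      obtain ⟨c, rfl⟩ := hxℓ
      exact (Submodule.span_singleton_smul_eq
        (IsUnit.mk0 c fun hc => hx0 (by rw [hc, zero_smul])) _).symm
    have hπx : ℓ.submodule.starProjection x = x := Submodule.starProjection_eq_self_iff.2 hxℓ
    have hπy : ℓ.submodule.starProjection (rot x) = 0 := by
      rw [Submodule.starProjection_apply_eq_zero_iff, hspan,
        Submodule.mem_orthogonal_singleton_iff_inner_right]
      exact inner_rot_self x
    have hy : ‖rot x‖ = 1 := (norm_rot x).trans hx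
    refine ⟨‖invLin g‖⁻¹ • invLin g x, ‖invLin g‖⁻¹ • invLin g (rot x), (hscale x hx).1,
      (hscale _ hy).1, (hscale x hx).2, (hscale _ hy).2, fun η j hj => ?_⟩
    obtain ⟨ℓ', hℓ', hd⟩ := hall η j hj
    have h1 := inner_invLin_le_of_distRP1_le hℓ' hd hx hy hπx hπy
    rw [invLin_mul] at h1
    simp only [ContinuousLinearMap.comp_apply] at h1
    have h2 : ‖(invLin (word φ η j)).comp (invLin g)‖ ^ 2 ≤
        (‖invLin (word φ η j)‖ * ‖invLin g‖) ^ 2 := by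
      gcongr
      exact ContinuousLinearMap.opNorm_comp_le _ _
    rw [map_smul, map_smul, inner_smul_left, inner_smul_right, RCLike.conj_to_real, ← mul_assoc,
      abs_mul, abs_of_nonneg (by positivity)]
    calc ‖invLin g‖⁻¹ * ‖invLin g‖⁻¹ * |inner ℝ (invLin (word φ η j) (invLin g x))
          (invLin (word φ η j) (invLin g (rot x)))|
        ≤ ‖invLin g‖⁻¹ * ‖invLin g‖⁻¹ * (2 * (1 / ((k : ℝ) + 1)) *
          (‖invLin (word φ η j)‖ * ‖invLin g‖) ^ 2) := by
          gcongr
          exact h1.trans (by gcongr)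
      _ = _ := by field_simp
  choose P Q hP hQ hRP hRQ hPQ using hstep
  have hcpt : IsCompact (Metric.closedBall (0 : Plane) 1 ×ˢ Metric.closedBall (0 : Plane) 1) :=
    (isCompact_closedBall _ _).prod (isCompact_closedBall _ _)
  obtain ⟨⟨P₀, Q₀⟩, -, σ, hσ, hlim⟩ := hcpt.tendsto_subseq (x := fun k => (P k, Q k))
    fun k => ⟨by simpa using hP k, by simpa using hQ k⟩
  have hlimP : Tendsto (fun k => P (σ k)) atTop (𝓝 P₀) :=
    (continuous_fst.tendsto (P₀, Q₀)).comp hlim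
  have hlimQ : Tendsto (fun k => Q (σ k)) atTop (𝓝 Q₀) :=
    (continuous_snd.tendsto (P₀, Q₀)).comp hlim
  have hP₀ : P₀ ≠ 0 := by
    rintro rfl
    have := ge_of_tendsto' (hlimP.norm.const_mul R) fun k => hRP (σ k)
    simp at this
    linarith
  have hQ₀ : Q₀ ≠ 0 := by
    rintro rfl
    have := ge_of_tendsto' (hlimQ.norm.const_mul R) fun k => hRQ (σ k)
    simp at this
    linarith
  have horth : ∀ (η : ℕ → Λ) (j : ℕ),
      inner ℝ (invLin (word φ η j) P₀) (invLin (word φ η j) Q₀) = 0 := by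
    intro η j
    have h1 : Tendsto (fun k => |inner ℝ (invLin (word φ η j) (P (σ k)))
        (invLin (word φ η j) (Q (σ k)))|) atTop
        (𝓝 |inner ℝ (invLin (word φ η j) P₀) (invLin (word φ η j) Q₀)|) :=
      ((((invLin (word φ η j)).continuous.tendsto _).comp hlimP).inner
        (((invLin (word φ η j)).continuous.tendsto _).comp hlimQ)).abs
    have h2 : Tendsto (fun k => 2 * (1 / ((σ k : ℝ) + 1)) * ‖invLin (word φ η j)‖ ^ 2) atTop
        (𝓝 (2 * 0 * ‖invLin (word φ η j)‖ ^ 2)) :=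
      ((tendsto_one_div_add_atTop_nhds_zero_nat.comp hσ.tendsto_atTop).const_mul 2).mul_const _
    have h3 := le_of_tendsto_of_tendsto h1 h2 (eventually_atTop.2 ⟨j, fun k hk =>
      hPQ (σ k) η j (hk.trans (hσ.id_le k))⟩)
    rw [mul_zero, zero_mul] at h3
    exact abs_eq_zero.1 (le_antisymm h3 (abs_nonneg _))
  have hPQ₀ : inner ℝ P₀ Q₀ = 0 := by
    have := horth (fun _ => Classical.arbitrary Λ) 0
    rwa [word, invLin_one] at this
  obtain ⟨c, hc⟩ := exists_eq_smul_rot hP₀ hPQ₀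
  have hc0 : c ≠ 0 := by
    rintro rfl
    exact hQ₀ (by rw [hc, zero_smul])
  refine false_of_orthogonal hnc hirr hP₀ fun η j => ?_
  have := horth η j
  rw [hc, map_smul, inner_smul_right] at this
  exact (mul_eq_zero.1 this).resolve_left hc0

/-- Almost surely, the direction of a word, if it exists, is a direction of slow growth. -/
theorem ae_wordDirection_le_slowSpace (p : PMF Λ) (hp : ∀ i, 0 < p i) (hnc : NonConformal φ)
    (hirr : TotallyIrreducible φ) :
    ∀ᵐ ω ∂(wordMeasure p), ∀ V, IsWordDirection φ ω V → V.submodule ≤ slowSpace φ ω := by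
  filter_upwards [ae_all_iff.2 fun R : ℕ => ae_condition_number_unbounded p hp hnc hirr R]
    with ω hω V hV v hv r hr
  obtain ⟨R, hR⟩ := exists_nat_gt (2 * ‖v‖ / r)
  have h1 := not_and.1 (hω R) ⟨V, hV⟩
  rw [not_frequently] at h1
  obtain ⟨ℓ, hℓ, hlim⟩ := hV
  have h2 := hlim.eventually (gt_mem_nhds (show 0 < r / (2 * (‖v‖ + 1)) by
    have : 0 < r := hr
    positivity))
  have hr0 : 0 < r := hr
  filter_upwards [h1, hℓ, h2] with n hn hnℓ hnd
  set g := word φ ω n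
  set w := (ℓ n).submodule.starProjection v
  have hN : 0 < ‖invLin g‖ := norm_invLin_pos g
  have hA : 0 < ‖lin g‖ := norm_lin_pos g
  have hw : ‖invLin g w‖ * ‖lin g‖ ≤ ‖v‖ :=
    ((hnℓ.mem_iff w).1 (Submodule.starProjection_apply_mem _ _)).trans
      (Submodule.norm_starProjection_apply_le _ _)
  -- The vector splits as `w + (v - w)` with `w` its projection to the current axis: the large
  -- condition number makes the first part slow, closeness of the axis to `V` makes the second part
  -- short.
  have hw' : ‖invLin g w‖ ≤ r / 2 * ‖invLin g‖ := by
    have h3 : 2 * ‖v‖ / r < ‖lin g‖ * ‖invLin g‖ := hR.trans (not_le.1 hn)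
    rw [div_lt_iff₀ hr0] at h3
    by_contra hcon
    push Not at hcon
    have : r / 2 * ‖invLin g‖ * ‖lin g‖ < ‖invLin g w‖ * ‖lin g‖ := by gcongr
    nlinarith
  have hvw : ‖v - w‖ ≤ r / 2 := by
    have hVv : V.submodule.starProjection v = v := Submodule.starProjection_eq_self_iff.2 hv
    have h3 := ((ℓ n).submodule.starProjection - V.submodule.starProjection).le_opNorm v
    rw [sub_apply, hVv, norm_sub_rev] at h3
    refine h3.trans ?_
    calc distRP1 (ℓ n) V * ‖v‖ ≤ r / (2 * (‖v‖ + 1)) * (‖v‖ + 1) := by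
          gcongr
          linarith
      _ = r / 2 := by field_simp
  calc ‖invLin g v‖ = ‖invLin g w + invLin g (v - w)‖ := by rw [← map_add, add_sub_cancel]
    _ ≤ ‖invLin g w‖ + ‖invLin g‖ * ‖v - w‖ :=
        (norm_add_le _ _).trans (by gcongr; exact (invLin g).le_opNorm _)
    _ ≤ r / 2 * ‖invLin g‖ + ‖invLin g‖ * (r / 2) := by gcongr
    _ = r * ‖invLin g‖ := by ring

end Directions

/-! ### Invariant subspaces of affine maps -/

section InvariantSubspaces

variable {Λ : Type*} {φ : Λ → Plane ≃ᵃ[ℝ] Plane}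

/-- The linear part of an affine map, as a linear map. -/
noncomputable def linPart : AffVec →ₗ[ℝ] (Plane →ₗ[ℝ] Plane) where
  toFun ψ := (ψ : Plane →ᵃ[ℝ] Plane).linear
  map_add' _ _ := rfl
  map_smul' _ _ := rfl

theorem affVec_apply_sub (ψ : AffVec) (x y : Plane) : ψ x - ψ y = linPart ψ (x - y) :=
  ((ψ : Plane →ᵃ[ℝ] Plane).linearMap_vsub x y).symm

theorem linPart_apply (ψ : AffVec) (v : Plane) : linPart ψ v = ψ v - ψ 0 := by
  rw [affVec_apply_sub, sub_zero]

theorem linPart_pull_apply (g : Plane ≃ᵃ[ℝ] Plane) (ψ : AffVec) (v : Plane) :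
    linPart (pull g ψ) v = invLin g (linPart ψ (lin g v)) := by
  rw [linPart_apply, pull_apply, pull_apply, ← map_sub, affVec_apply_sub, affine_sub, sub_zero]

theorem linPart_pull (g : Plane ≃ᵃ[ℝ] Plane) (ψ : AffVec) :
    linPart (pull g ψ) = g.linear.symm.conj (linPart ψ) :=
  LinearMap.ext fun v => linPart_pull_apply g ψ v

/-- The composition of the linear part of an affine map with another affine map. -/
noncomputable def linComp : AffVec →ₗ[ℝ] AffVec →ₗ[ℝ] AffVec :=
  LinearMap.mk₂ ℝ
    (fun ψ' ψ => (LinearMap.toContinuousLinearMap (linPart ψ')).toContinuousAffineMap.comp ψ)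
    (fun ψ₁ ψ₂ ψ => by ext1 x; rfl)
    (fun c ψ' ψ => by ext1 x; rfl)
    (fun ψ' ψ₁ ψ₂ => by ext1 x; exact (linPart ψ').map_add _ _)
    (fun c ψ' ψ => by ext1 x; exact (linPart ψ').map_smul _ _)

theorem linComp_apply (ψ' ψ : AffVec) (x : Plane) : linComp ψ' ψ x = linPart ψ' (ψ x) := rfl

theorem linPart_linComp (ψ' ψ : AffVec) : linPart (linComp ψ' ψ) = linPart ψ' * linPart ψ :=
  rfl

theorem pull_linComp (g : Plane ≃ᵃ[ℝ] Plane) (ψ' ψ : AffVec) :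
    pull g (linComp ψ' ψ) = linComp (pull g ψ') (pull g ψ) := by
  ext1 x
  rw [pull_apply, linComp_apply, linComp_apply, linPart_pull_apply, pull_apply, lin_invLin]

/-- The trace form on affine maps. -/
noncomputable def traceForm : LinearMap.BilinForm ℝ AffVec :=
  ((LinearMap.mul ℝ (Module.End ℝ Plane)).compl₁₂ linPart linPart).compr₂
    (LinearMap.trace ℝ Plane)

theorem traceForm_apply (ψ ψ' : AffVec) :
    traceForm ψ ψ' = LinearMap.trace ℝ Plane (linPart ψ * linPart ψ') := rfl

theorem traceForm_comm (ψ ψ' : AffVec) : traceForm ψ ψ' = traceForm ψ' ψ := by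
  rw [traceForm_apply, traceForm_apply, LinearMap.trace_mul_comm]

theorem traceForm_pull (g : Plane ≃ᵃ[ℝ] Plane) (ψ ψ' : AffVec) :
    traceForm (pull g ψ) (pull g ψ') = traceForm ψ ψ' := by
  rw [traceForm_apply, traceForm_apply, linPart_pull, linPart_pull]
  have : g.linear.symm.conj (linPart ψ) * g.linear.symm.conj (linPart ψ') =
      g.linear.symm.conj (linPart ψ * linPart ψ') := (LinearEquiv.conj_comp _ _ _).symm
  rw [this, LinearMap.trace_conj']

/-- A nondegenerate invariant bilinear form contracts bilinear maps in an invariant way. -/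
theorem sum_dual_eq {W E ι : Type*} [Fintype ι] [AddCommGroup W] [Module ℝ W] [AddCommGroup E]
    [Module ℝ E] {β : LinearMap.BilinForm ℝ W} {b b' : ι → W}
    (h1 : ∀ x, x = ∑ j, β x (b j) • b' j) (h2 : ∀ y, y = ∑ j, β (b' j) y • b j)
    (T : W ≃ₗ[ℝ] W) (hT : ∀ x y, β (T x) (T y) = β x y) (Q : W →ₗ[ℝ] W →ₗ[ℝ] E) :
    ∑ j, Q (T (b' j)) (T (b j)) = ∑ j, Q (b' j) (b j) := by
  calc ∑ j, Q (T (b' j)) (T (b j))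
      = ∑ j, Q (∑ k, β (T (b' j)) (b k) • b' k) (T (b j)) :=
        Finset.sum_congr rfl fun j _ => by rw [← h1]
    _ = ∑ j, ∑ k, β (T (b' j)) (b k) • Q (b' k) (T (b j)) := by simp
    _ = ∑ k, ∑ j, β (T (b' j)) (b k) • Q (b' k) (T (b j)) := Finset.sum_comm
    _ = ∑ k, Q (b' k) (T (∑ j, β (b' j) (T.symm (b k)) • b j)) := by
        refine Finset.sum_congr rfl fun k _ => ?_
        simp only [map_sum, map_smul]
        refine Finset.sum_congr rfl fun j _ => ?_
        rw [← hT (b' j), T.apply_symm_apply]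
    _ = ∑ k, Q (b' k) (b k) := Finset.sum_congr rfl fun k _ => by rw [← h2, T.apply_symm_apply]

/-- The kernel of a nonzero, non-injective map of the plane is a single line, here preserved by all
linear parts. -/
theorem TotallyIrreducible.false_of_ker (hirr : TotallyIrreducible φ) {C : Plane →ₗ[ℝ] Plane}
    (hC : C ≠ 0) {v : Plane} (hv : v ≠ 0) (hCv : C v = 0)
    (hinv : ∀ i w, C w = 0 → C (lin (φ i) w) = 0) : False := by
  refine hirr.false_of_vectors (F := {v}) (by simp) (by simp) (by simpa using hv) ?_
  intro i w hw
  rw [Set.mem_singleton_iff.1 hw]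
  refine ⟨v, rfl, ?_⟩
  obtain ⟨s, t, hst⟩ := exists_eq_add_smul_rot hv (lin (φ i) v)
  refine ⟨s, ?_⟩
  have h1 := hinv i v hCv
  rw [hst, map_add, map_smul, map_smul, hCv, smul_zero, zero_add] at h1
  rcases smul_eq_zero.1 h1 with rfl | h2
  · rw [hst, zero_smul, add_zero]
  · refine absurd (LinearMap.ext fun x => ?_) hC
    obtain ⟨a, b, rfl⟩ := exists_eq_add_smul_rot hv x
    simp [hCv, h2]

/-- Invariance means `ψ ∘ φ_i = A_i ∘ ψ`. If the linear part is injective, the unique zero of `ψ` is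
fixed by every `φ_i`; otherwise its kernel is an invariant line. -/
theorem false_of_pull_eq (hirr : TotallyIrreducible φ) (hfix : ¬ ∃ x, ∀ i, φ i x = x)
    {ψ : AffVec} (hψ : linPart ψ ≠ 0) (h : ∀ i, pull (φ i) ψ = ψ) : False := by
  have hx : ∀ i x, ψ (φ i x) = lin (φ i) (ψ x) := by
    intro i x
    conv_rhs => rw [← h i, pull_apply, lin_invLin]
  by_cases hinj : Function.Injective (linPart ψ)
  · obtain ⟨c, hc⟩ := LinearMap.surjective_of_injective hinj (-ψ 0)
    have hc0 : ψ c = 0 := by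
      rw [linPart_apply] at hc
      have := sub_eq_iff_eq_add.1 hc
      rwa [neg_add_cancel] at this
    refine hfix ⟨c, fun i => ?_⟩
    have h1 : linPart ψ (φ i c - c) = 0 := by
      rw [← affVec_apply_sub, hx, hc0, map_zero, sub_zero]
    exact sub_eq_zero.1 ((map_eq_zero_iff _ hinj).1 h1)
  · rw [← LinearMap.ker_eq_bot, Submodule.eq_bot_iff] at hinj
    push Not at hinj
    obtain ⟨v, hv, hv0⟩ := hinj
    refine hirr.false_of_ker hψ hv0 hv fun i w hw => ?_
    have h1 := linPart_pull_apply (φ i) ψ w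
    rw [h i, hw] at h1
    exact (invLin_eq_zero_iff _ _).1 h1.symm

theorem trace_plane (B : Plane →ₗ[ℝ] Plane) : LinearMap.trace ℝ Plane B =
    B (EuclideanSpace.single 0 1) 0 + B (EuclideanSpace.single 1 1) 1 := by
  rw [LinearMap.trace_eq_matrix_trace ℝ (EuclideanSpace.basisFun (Fin 2) ℝ).toBasis,
    Matrix.trace, Fin.sum_univ_two]
  simp [LinearMap.toMatrix_apply]

theorem linearMap_plane_apply (B : Plane →ₗ[ℝ] Plane) (x : Plane) :
    B x = x 0 • B (EuclideanSpace.single 0 1) + x 1 • B (EuclideanSpace.single 1 1) := by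
  rw [← map_smul, ← map_smul, ← map_add]
  congr 1
  ext i
  fin_cases i <;> simp

theorem trace_mul_plane (B C : Plane →ₗ[ℝ] Plane) : LinearMap.trace ℝ Plane (B * C) =
    B (EuclideanSpace.single 0 1) 0 * C (EuclideanSpace.single 0 1) 0 +
    B (EuclideanSpace.single 1 1) 0 * C (EuclideanSpace.single 0 1) 1 +
    (B (EuclideanSpace.single 0 1) 1 * C (EuclideanSpace.single 1 1) 0 +
    B (EuclideanSpace.single 1 1) 1 * C (EuclideanSpace.single 1 1) 1) := by
  rw [trace_plane, Module.End.mul_apply, Module.End.mul_apply,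
    linearMap_plane_apply B (C (EuclideanSpace.single 0 1)),
    linearMap_plane_apply B (C (EuclideanSpace.single 1 1))]
  simp only [PiLp.add_apply, PiLp.smul_apply, smul_eq_mul]
  ring

/-- For symmetric matrices the trace of the square is the sum of the squares of the entries. -/
theorem linearMap_plane_eq_zero_of_isotropic {B : Plane →ₗ[ℝ] Plane}
    (h : LinearMap.trace ℝ Plane (B * B) = 0)
    (h' : B (EuclideanSpace.single 1 1) 0 = B (EuclideanSpace.single 0 1) 1) : B = 0 := by
  rw [trace_mul_plane, h'] at h
  have h0 : B (EuclideanSpace.single 0 1) = 0 := by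
    ext i
    fin_cases i
    · simp only [Fin.zero_eta, PiLp.zero_apply]
      nlinarith [sq_nonneg (B (EuclideanSpace.single 0 1) 0),
        sq_nonneg (B (EuclideanSpace.single 0 1) 1), sq_nonneg (B (EuclideanSpace.single 1 1) 1)]
    · simp only [Fin.mk_one, PiLp.zero_apply]
      nlinarith [sq_nonneg (B (EuclideanSpace.single 0 1) 0),
        sq_nonneg (B (EuclideanSpace.single 0 1) 1), sq_nonneg (B (EuclideanSpace.single 1 1) 1)]
  have h1 : B (EuclideanSpace.single 1 1) = 0 := by
    rw [h0] at h h'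
    ext i
    fin_cases i
    · simpa using h'
    · simpa using h
  refine LinearMap.ext fun x => ?_
  rw [linearMap_plane_apply, h0, h1]
  simp

/-- An isotropic subspace meets the hyperplane of symmetric matrices only in zero, so it has
dimension at most one; `c` cancels the antisymmetric part. -/
theorem exists_eq_smul_of_isotropic {B C : Plane →ₗ[ℝ] Plane} (hB : B ≠ 0)
    (h1 : LinearMap.trace ℝ Plane (B * B) = 0) (h2 : LinearMap.trace ℝ Plane (B * C) = 0)
    (h3 : LinearMap.trace ℝ Plane (C * C) = 0) : ∃ c : ℝ, C = c • B := by
  set v := B (EuclideanSpace.single 1 1) 0 - B (EuclideanSpace.single 0 1) 1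
  set w := C (EuclideanSpace.single 1 1) 0 - C (EuclideanSpace.single 0 1) 1
  have hv : v ≠ 0 := fun hv => hB (linearMap_plane_eq_zero_of_isotropic h1 (sub_eq_zero.1 hv))
  refine ⟨w / v, sub_eq_zero.1 (linearMap_plane_eq_zero_of_isotropic ?_ ?_)⟩
  · have h2' : LinearMap.trace ℝ Plane (C * B) = 0 := by rwa [LinearMap.trace_mul_comm]
    simp only [sub_mul, mul_sub, smul_mul_assoc, mul_smul_comm, map_sub, map_smul, h1, h2, h2', h3]
    simp
  · simp only [LinearMap.sub_apply, LinearMap.smul_apply, PiLp.sub_apply, PiLp.smul_apply,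
      smul_eq_mul]
    have : w / v * v = w := div_mul_cancel₀ w hv
    simp only [v, w] at this ⊢
    linear_combination -this

/-- Cayley–Hamilton: when the trace of the square vanishes, the determinant is half the square of
the trace. -/
theorem linearMap_plane_sq_apply {B : Plane →ₗ[ℝ] Plane}
    (h : LinearMap.trace ℝ Plane (B * B) = 0) (x : Plane) :
    B (B x) = LinearMap.trace ℝ Plane B • B x - (LinearMap.trace ℝ Plane B ^ 2 / 2) • x := by
  rw [trace_mul_plane] at h
  rw [linearMap_plane_apply B (B x), linearMap_plane_apply B x, trace_plane]
  ext i
  fin_cases i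
  · simp
    linear_combination (x 0 / 2) * h
  · simp
    linear_combination (x 1 / 2) * h

/-- In the basis `v, J v` a map commuting with `J` is multiplication by a complex number `α + iβ`, a
similarity of ratio `√(α² + β²)`. -/
theorem NonConformal.false_of_complexStructure (hnc : NonConformal φ) {J : Plane →ₗ[ℝ] Plane}
    (hJ : ∀ x, J (J x) = -x) (hcomm : ∀ i x, J (lin (φ i) x) = lin (φ i) (J x)) : False := by
  obtain ⟨v, hv⟩ := exists_ne (0 : Plane)
  let h₀ : Plane →ₗ[ℝ] Plane :=
    (EuclideanSpace.proj 0 : Plane →L[ℝ] ℝ).toLinearMap.smulRight v +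
    (EuclideanSpace.proj 1 : Plane →L[ℝ] ℝ).toLinearMap.smulRight (J v)
  have h₀_apply : ∀ x, h₀ x = x 0 • v + x 1 • J v := fun x => rfl
  have hinj : Function.Injective h₀ := by
    rw [← LinearMap.ker_eq_bot, LinearMap.ker_eq_bot']
    intro x hx
    by_contra hx0
    have h1 : (x 0 ^ 2 + x 1 ^ 2) • v = x 0 • h₀ x - x 1 • J (h₀ x) := by
      rw [h₀_apply, map_add, map_smul, map_smul, hJ]
      module
    rw [hx, map_zero, smul_zero, smul_zero, sub_zero] at h1
    exact (norm_sq_plane_pos hx0).ne' ((smul_eq_zero.1 h1).resolve_right hv)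
  let h : Plane ≃ₗ[ℝ] Plane := LinearEquiv.ofInjectiveEndo h₀ hinj
  have h_apply : ∀ x, h x = x 0 • v + x 1 • J v := fun x => rfl
  refine hnc ⟨h.symm.toAffineEquiv, fun i => ?_⟩
  set α := (h.symm (lin (φ i) v)) 0 with hα
  set β := (h.symm (lin (φ i) v)) 1 with hβ
  have hAv : lin (φ i) v = α • v + β • J v := by
    rw [hα, hβ, ← h_apply, h.apply_symm_apply]
  have hA : ∀ x, h.symm (lin (φ i) (h x)) = !₂[α * x 0 - β * x 1, β * x 0 + α * x 1] := by
    intro x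
    rw [LinearEquiv.symm_apply_eq, h_apply, h_apply, map_add, map_smul, map_smul, ← hcomm, hAv,
      map_add, map_smul, map_smul, hJ]
    simp
    module
  refine ⟨Real.sqrt (α ^ 2 + β ^ 2), fun x y => ?_⟩
  change dist (h.symm (φ i (h x))) (h.symm (φ i (h y))) = _
  rw [dist_eq_norm, dist_eq_norm, ← map_sub, affine_sub, ← map_sub, hA]
  refine (pow_left_inj₀ (norm_nonneg _) (by positivity) two_ne_zero).1 ?_
  rw [mul_pow, Real.sq_sqrt (by positivity), norm_sq_plane, norm_sq_plane]
  simp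
  ring

/-- A non-conformal totally irreducible system without common fixed point admits no invariant
subspace of affine maps, apart from those containing all the constant maps. -/
theorem false_of_invariant_subspace (hnc : NonConformal φ) (hirr : TotallyIrreducible φ)
    (hfix : ¬ ∃ x, ∀ i, φ i x = x) {W : Submodule ℝ AffVec} (hW : W ≠ ⊥)
    (hinv : ∀ i, ∀ ψ ∈ W, pull (φ i) ψ ∈ W) {N : Submodule ℝ Plane} (hN : N ≠ ⊤)
    (hconst : ∀ ψ ∈ W, linPart ψ = 0 → ψ 0 ∈ N) : False := by
  by_cases hdeg : ∃ ψ ∈ W, ψ ≠ 0 ∧ ∀ ψ' ∈ W, traceForm ψ ψ' = 0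
  · obtain ⟨ψ, hψW, hψ0, hψ⟩ := hdeg
    -- A constant radical element has its value, and the images of that value under all `invLin (φ
    -- i)`, in the proper subspace `N`, which must then be an invariant line.
    by_cases hB : linPart ψ = 0
    · have hv : ψ 0 ≠ 0 := by
        intro h0
        refine hψ0 (ContinuousAffineMap.ext fun x => ?_)
        have := linPart_apply ψ x
        rw [hB, h0, sub_zero] at this
        exact this.symm
      have hvN := hconst ψ hψW hB
      refine hirr.false_of_vectors (F := {ψ 0}) (by simp) (by simp) (by simpa using hv) ?_
      rintro i _ rfl
      refine ⟨_, rfl, ?_⟩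
      have h1 : pull (φ i) ψ 0 = invLin (φ i) (ψ 0) := by
        have := linPart_apply ψ (φ i 0)
        rw [hB] at this
        rw [pull_apply, sub_eq_zero.1 this.symm]
      have h2 : invLin (φ i) (ψ 0) ∈ N := by
        rw [← h1]
        refine hconst _ (hinv i ψ hψW) ?_
        rw [linPart_pull, hB, map_zero]
      obtain ⟨s, t, hst⟩ := exists_eq_add_smul_rot hv (invLin (φ i) (ψ 0))
      have ht : t = 0 := by
        by_contra ht
        refine hN (Submodule.eq_top_iff'.2 fun x => ?_)
        have h3 : t • rot (ψ 0) ∈ N := by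
          rw [hst] at h2
          exact (Submodule.add_mem_iff_right N (N.smul_mem s hvN)).1 h2
        have h4 : rot (ψ 0) ∈ N := (Submodule.smul_mem_iff N ht).1 h3
        obtain ⟨a, b, rfl⟩ := exists_eq_add_smul_rot hv x
        exact N.add_mem (N.smul_mem a hvN) (N.smul_mem b h4)
      rw [ht, zero_smul, add_zero] at hst
      exact exists_lin_eq_smul hv hst
    · set C := linPart ψ
      have hCC : LinearMap.trace ℝ Plane (C * C) = 0 := hψ ψ hψW
      have hconj : ∀ i, ∃ c : ℝ, linPart (pull (φ i) ψ) = c • C := by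
        intro i
        refine exists_eq_smul_of_isotropic hB hCC (hψ _ (hinv i ψ hψW)) ?_
        rw [← traceForm_apply, traceForm_pull, traceForm_apply]
        exact hCC
      have hker : ∀ v, v ≠ 0 → C v ≠ 0 := by
        intro v hv hCv
        refine hirr.false_of_ker hB hv hCv fun i w hw => ?_
        obtain ⟨c, hc⟩ := hconj i
        have h1 := linPart_pull_apply (φ i) ψ w
        rw [hc, LinearMap.smul_apply, hw, smul_zero] at h1
        exact (invLin_eq_zero_iff _ _).1 h1.symm
      set t := LinearMap.trace ℝ Plane C with ht
      -- With zero trace, Cayley–Hamilton would give `C² = 0`, against injectivity. The nonzero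
      -- trace is invariant under conjugation, so the factor `c` is 1 and `C` commutes with all
      -- linear parts.
      have ht0 : t ≠ 0 := by
        intro ht0
        obtain ⟨v, hv⟩ := exists_ne (0 : Plane)
        refine hker (C v) (hker v hv) ?_
        rw [linearMap_plane_sq_apply hCC, ← ht, ht0]
        simp
      have hcomm : ∀ i x, C (lin (φ i) x) = lin (φ i) (C x) := by
        intro i x
        obtain ⟨c, hc⟩ := hconj i
        have h1 : LinearMap.trace ℝ Plane (linPart (pull (φ i) ψ)) = t := by
          rw [linPart_pull, LinearMap.trace_conj']
        rw [hc, map_smul, ← ht, smul_eq_mul] at h1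
        have hc1 : c = 1 := by
          have := mul_right_cancel₀ ht0 (h1.trans (one_mul t).symm)
          exact this
        have h2 := linPart_pull_apply (φ i) ψ x
        rw [hc, hc1, one_smul] at h2
        rw [h2, lin_invLin]
      refine hnc.false_of_complexStructure (J := (2 / t) • C - LinearMap.id) (fun x => ?_)
        fun i x => ?_
      · simp only [LinearMap.sub_apply, LinearMap.smul_apply, LinearMap.id_apply, map_sub,
          map_smul, linearMap_plane_sq_apply hCC, ← ht]
        match_scalars
        · field_simp
          ring
        · field_simp
          ring
      · simp only [LinearMap.sub_apply, LinearMap.smul_apply, LinearMap.id_apply, map_sub,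
          map_smul, hcomm]
  · push Not at hdeg
    let β : LinearMap.BilinForm ℝ W := traceForm.restrict W
    have hβ : ∀ x y : W, β x y = traceForm x y := fun x y => rfl
    have hsep : ∀ x : W, (∀ y, β x y = 0) → x = 0 := by
      intro x hx
      by_contra hx0
      obtain ⟨ψ', hψ', h0⟩ := hdeg x x.2 fun h => hx0 (Subtype.ext h)
      exact h0 (hx ⟨ψ', hψ'⟩)
    have hnd : β.Nondegenerate := by
      refine ⟨hsep, fun y hy => hsep y fun x => ?_⟩
      rw [hβ, traceForm_comm]
      exact hy x
    let b := Module.finBasis ℝ W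
    let b' := β.dualBasis hnd b
    have h1 : ∀ x, x = ∑ j, β x (b j) • b' j := by
      intro x
      conv_lhs => rw [← b'.sum_repr x]
      exact Finset.sum_congr rfl fun j _ => by
        rw [LinearMap.BilinForm.dualBasis_repr_apply]
    have h2 : ∀ y, y = ∑ j, β (b' j) y • b j := by
      intro y
      have hrep : ∀ j, β (b' j) y = b.repr y j := by
        intro j
        have h3 := congrArg (β (b' j)) (b.sum_repr y)
        rw [← h3, map_sum]
        simp only [map_smul, b', LinearMap.BilinForm.apply_dualBasis_left, smul_eq_mul, mul_ite,
          mul_one, mul_zero, Finset.sum_ite_eq', Finset.mem_univ, if_true]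
      conv_lhs => rw [← b.sum_repr y]
      exact Finset.sum_congr rfl fun j _ => by rw [hrep]
    let Q : W →ₗ[ℝ] W →ₗ[ℝ] AffVec := linComp.compl₁₂ W.subtype W.subtype
    have hQ : ∀ x y : W, Q x y = linComp x y := fun x y => rfl
    -- The Casimir element of the form on `W`. Each summand has a linear part of trace 1, so the
    -- trace is the dimension of `W`, which is not zero.
    refine false_of_pull_eq hirr hfix (ψ := ∑ j, Q (b' j) (b j)) ?_ fun i => ?_
    · intro h0
      have h3 := congrArg (LinearMap.trace ℝ Plane) h0
      rw [map_zero, map_sum, map_sum] at h3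
      have h4 : ∀ j, LinearMap.trace ℝ Plane (linPart (Q (b' j) (b j))) = 1 := by
        intro j
        have h5 : LinearMap.trace ℝ Plane (linPart (Q (b' j) (b j))) = β (b' j) (b j) := by
          rw [hQ, linPart_linComp, hβ, traceForm_apply]
        rw [h5]
        simp [b', LinearMap.BilinForm.apply_dualBasis_left]
      simp only [h4, Finset.sum_const, Finset.card_univ, Fintype.card_fin, nsmul_eq_mul,
        mul_one, Nat.cast_eq_zero] at h3
      exact hW (Submodule.finrank_eq_zero.1 h3)
    · let T₀ : W →ₗ[ℝ] W := (pull (φ i)).restrict (hinv i)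
      have hT₀ : Function.Injective T₀ := fun x y hxy =>
        Subtype.ext (pull_injective (φ i) (congrArg Subtype.val hxy))
      let T : W ≃ₗ[ℝ] W := LinearEquiv.ofInjectiveEndo T₀ hT₀
      have hT : ∀ x : W, ((T x : W) : AffVec) = pull (φ i) x := fun x => rfl
      have h3 := sum_dual_eq h1 h2 T (fun x y => by
        rw [hβ, hβ, hT, hT, traceForm_pull]) Q
      rw [map_sum, ← h3]
      refine Finset.sum_congr rfl fun j _ => ?_
      rw [hQ, hQ, hT, hT, pull_linComp]

end InvariantSubspaces

/-! ### Affine maps do not follow the slow directions -/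

section NullSets

variable {Λ : Type*} [Fintype Λ] [Nonempty Λ] [MeasurableSpace Λ] [DiscreteMeasurableSpace Λ]
  {φ : Λ → Plane ≃ᵃ[ℝ] Plane}

/-- Evaluation at a point, as a linear map. -/
noncomputable def evalAt (x : Plane) : AffVec →ₗ[ℝ] Plane where
  toFun ψ := ψ x
  map_add' _ _ := rfl
  map_smul' _ _ := rfl

variable (φ) in
/-- The vectors that are almost surely mapped to the slow space. -/
noncomputable def aeSlow {E : Type*} [AddCommGroup E] [Module ℝ E] (p : PMF Λ)
    (f : (ℕ → Λ) → E →ₗ[ℝ] Plane) : Submodule ℝ E where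
  carrier := {x | ∀ᵐ ω ∂(wordMeasure p), f ω x ∈ slowSpace φ ω}
  zero_mem' := ae_of_all _ fun ω => by
    rw [map_zero]
    exact (slowSpace φ ω).zero_mem
  add_mem' := fun {x y} hx hy => by
    change ∀ᵐ ω ∂(wordMeasure p), f ω (x + y) ∈ slowSpace φ ω
    filter_upwards [hx, hy] with ω h1 h2
    rw [map_add]
    exact (slowSpace φ ω).add_mem h1 h2
  smul_mem' := fun c x hx => by
    change ∀ᵐ ω ∂(wordMeasure p), f ω (c • x) ∈ slowSpace φ ω
    filter_upwards [hx] with ω h1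
    rw [map_smul]
    exact (slowSpace φ ω).smul_mem c h1

theorem mem_aeSlow {E : Type*} [AddCommGroup E] [Module ℝ E] {p : PMF Λ}
    {f : (ℕ → Λ) → E →ₗ[ℝ] Plane} {x : E} :
    x ∈ aeSlow φ p f ↔ ∀ᵐ ω ∂(wordMeasure p), f ω x ∈ slowSpace φ ω := Iff.rfl

theorem exists_unit_concat_subset (hφ : ∀ i, ∃ K : ℝ≥0, ContractingWith K (φ i)) {ψ : AffVec}
    (hψ : ψ ≠ 0) (n : ℕ) (ω : ℕ → Λ) : ∃ ψ' : AffVec, ‖ψ'‖ = 1 ∧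
      {η | concat n ω η ∈ slowSet φ 0 ψ} ⊆ slowSet φ 0 ψ' := by
  have hne : ‖pull (word φ ω n) ψ‖ ≠ 0 := fun h =>
    hψ (pull_injective _ ((norm_eq_zero.1 h).trans (map_zero _).symm))
  refine ⟨‖pull (word φ ω n) ψ‖⁻¹ • pull (word φ ω n) ψ, ?_, fun η hη => ?_⟩
  · rw [norm_smul, norm_inv, norm_norm, inv_mul_cancel₀ hne]
  · have hη' : concat n ω η ∈ slowSet φ 0 ψ := hη
    have h1 : η ∈ slowSet φ 0 (pull (word φ ω n) ψ) := mem_slowSet_of_concat hφ hη'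
    have h2 := slowSet_smul_subset (‖pull (word φ ω n) ψ‖⁻¹) (pull (word φ ω n) ψ) h1
    rw [mul_zero] at h2
    exact h2

/-- Zooming in at a typical point of a set of positive measure. -/
theorem exists_unit_ae_mem_slowSet (p : PMF Λ)
    (hφ : ∀ i, ∃ K : ℝ≥0, ContractingWith K (φ i)) {ψ : AffVec} (hψ : ψ ≠ 0)
    (hpos : wordMeasure p (slowSet φ 0 ψ) ≠ 0) :
    ∃ ψ₀ : AffVec, ‖ψ₀‖ = 1 ∧ ∀ᵐ ω ∂(wordMeasure p), ω ∈ slowSet φ 0 ψ₀ := by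
  have hex : ∃ ω, Tendsto
      (fun n => (wordMeasure p).real {η | concat n ω η ∈ slowSet φ 0 ψ}) atTop (𝓝 1) := by
    by_contra hcon
    push Not at hcon
    refine hpos (measure_eq_zero_iff_ae_notMem.2 ?_)
    filter_upwards [tendsto_measureReal_concat p (measurableSet_slowSet hφ 0 ψ)] with ω hω hω'
    rw [Set.indicator_of_mem hω'] at hω
    exact hcon ω hω
  obtain ⟨ω, hω⟩ := hex
  choose ψs hunit hsub using fun n => exists_unit_concat_subset hφ hψ n ω
  obtain ⟨ψ₀, hψ₀, hfull⟩ := exists_unit_slowSet_limit hφ p hunit tendsto_const_nhds hω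
    fun n => measureReal_mono (hsub n) (measure_ne_top _ _)
  refine ⟨ψ₀, hψ₀, ?_⟩
  have h1 : (wordMeasure p).real (slowSet φ 0 ψ₀) = 1 := le_antisymm measureReal_le_one hfull
  rw [measureReal_def, ENNReal.toReal_eq_one_iff] at h1
  exact (prob_compl_eq_zero_iff (measurableSet_slowSet hφ 0 ψ₀)).2 h1

/-- Zooming in upgrades positive measure to full measure. Being almost surely slow is a linear
condition on `ψ`, inherited by `pull (φ i) ψ` because the first letter may be prescribed. -/
theorem measure_slowSet_eq_zero (p : PMF Λ) (hp : ∀ i, 0 < p i)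
    (hφ : ∀ i, ∃ K : ℝ≥0, ContractingWith K (φ i)) (hfix : ¬ ∃ x, ∀ i, φ i x = x)
    (hnc : NonConformal φ) (hirr : TotallyIrreducible φ) {ψ : AffVec} (hψ : ψ ≠ 0) :
    wordMeasure p (slowSet φ 0 ψ) = 0 := by
  by_contra hpos
  obtain ⟨ψ₀, hψ₀, hae⟩ := exists_unit_ae_mem_slowSet p hφ hψ hpos
  let W : Submodule ℝ AffVec := aeSlow φ p fun ω => evalAt (codingMap φ ω)
  let N : Submodule ℝ Plane := aeSlow φ p fun _ => LinearMap.id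
  refine false_of_invariant_subspace hnc hirr hfix (W := W) (N := N) ?_ ?_ ?_ ?_
  · intro hbot
    have : ψ₀ ∈ W := hae
    rw [hbot, Submodule.mem_bot] at this
    rw [this, norm_zero] at hψ₀
    exact zero_ne_one hψ₀
  · intro i ψ hψW
    filter_upwards [ae_concat_one p hp (E := slowSet φ 0 ψ) hψW i] with η hη
    have := mem_slowSet_of_concat hφ hη
    rw [word_one] at this
    exact this
  · intro htop
    have h0 : EuclideanSpace.single 0 1 ∈ N := htop ▸ trivial
    have h1 : EuclideanSpace.single 1 1 ∈ N := htop ▸ trivial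
    rw [mem_aeSlow] at h0 h1
    obtain ⟨ω, hω0, hω1⟩ := (h0.and h1).exists
    refine slowSpace_ne_top (φ := φ) (ω := ω) (Submodule.eq_top_iff'.2 fun x => ?_)
    have hx : x = x 0 • EuclideanSpace.single 0 1 + x 1 • EuclideanSpace.single 1 1 := by
      ext i
      fin_cases i <;> simp
    rw [hx]
    exact Submodule.add_mem _ (Submodule.smul_mem _ _ hω0) (Submodule.smul_mem _ _ hω1)
  · intro ψ hψW hlin
    rw [mem_aeSlow] at hψW ⊢
    filter_upwards [hψW] with ω hω
    have := linPart_apply ψ (codingMap φ ω)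
    rw [hlin] at this
    change ψ (codingMap φ ω) ∈ slowSpace φ ω at hω
    rwa [sub_eq_zero.1 this.symm] at hω

end NullSets

/-! ### The direction function does not follow affine maps -/

section Disintegration

variable {Λ : Type*} [Fintype Λ] [Nonempty Λ] [MeasurableSpace Λ] [DiscreteMeasurableSpace Λ]
  {φ : Λ → Plane ≃ᵃ[ℝ] Plane}

/-- Transfers estimates from points to words: the fibre measure over almost every point of `E` is
carried by `H`, and integrating the fibre masses gives the mass of `H`. The set `E` need not be
measurable. -/
theorem selfAffineMeasure_le_of_condDistrib (p : PMF Λ)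
    (hφ : ∀ i, ∃ K : ℝ≥0, ContractingWith K (φ i)) {P : (ℕ → Λ) → Prop}
    (hP : ∀ᵐ ω ∂(wordMeasure p), P ω) {H : Set (ℕ → Λ)} (hH : MeasurableSet H) {E : Set Plane}
    (h : ∀ x ∈ E, ∀ᵐ ω ∂(condDistrib id (codingMap φ) (wordMeasure p) x),
      codingMap φ ω = x → P ω → ω ∈ H) :
    selfAffineMeasure φ p E ≤ wordMeasure p H := by
  set κ := condDistrib id (codingMap φ) (wordMeasure p)
  have hcod := measurable_codingMap φ hφ
  have hprob : IsProbabilityMeasure (selfAffineMeasure φ p) :=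
    Measure.isProbabilityMeasure_map hcod.aemeasurable
  have hcomp : selfAffineMeasure φ p ⊗ₘ κ =
      (wordMeasure p).map (fun ω => (codingMap φ ω, ω)) :=
    compProd_map_condDistrib (Y := id) (X := codingMap φ) aemeasurable_id
  have hgraph : Measurable fun ω => (codingMap φ ω, ω) := hcod.prodMk measurable_id
  -- A measurable null set containing the failures of `P`, which itself need not be measurable.
  let Z := toMeasurable (wordMeasure p) {ω | ¬ P ω}
  have hZ0 : wordMeasure p Z = 0 := by rw [measure_toMeasurable]; exact hP
  have hZP : ∀ ω, ω ∉ Z → P ω := fun ω hω => by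
    by_contra hPω
    exact hω (subset_toMeasurable _ _ hPω)
  have hae : ∀ᵐ q ∂(selfAffineMeasure φ p ⊗ₘ κ), codingMap φ q.2 = q.1 ∧ q.2 ∉ Z := by
    have hm : MeasurableSet {q : Plane × (ℕ → Λ) | codingMap φ q.2 = q.1 ∧ q.2 ∉ Z} :=
      (measurableSet_eq_fun (hcod.comp measurable_snd) measurable_fst).inter
        (measurable_snd (measurableSet_toMeasurable _ _).compl)
    rw [hcomp, ae_map_iff hgraph.aemeasurable hm]
    filter_upwards [measure_eq_zero_iff_ae_notMem.1 hZ0] with ω hω using ⟨rfl, hω⟩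
  have hsec := Measure.ae_ae_of_ae_compProd hae
  have hκm : Measurable fun x => κ x H := Kernel.measurable_coe κ hH
  have hle : ∀ᵐ x ∂(selfAffineMeasure φ p), x ∈ E → x ∈ {x | 1 ≤ κ x H} := by
    filter_upwards [hsec] with x hx hxE
    have h1 : ∀ᵐ ω ∂(κ x), ω ∈ H := by
      filter_upwards [hx, h x hxE] with ω h2 h3 using h3 h2.1 (hZP ω h2.2)
    exact (prob_compl_eq_zero_iff hH |>.1 h1).ge
  calc selfAffineMeasure φ p E ≤ selfAffineMeasure φ p {x | 1 ≤ κ x H} := measure_mono_ae hle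
    _ ≤ ∫⁻ x, κ x H ∂(selfAffineMeasure φ p) := by
      simpa using mul_meas_ge_le_lintegral (μ := selfAffineMeasure φ p) hκm 1
    _ = (selfAffineMeasure φ p ⊗ₘ κ) (Set.univ ×ˢ H) := by
      rw [Measure.compProd_apply_prod MeasurableSet.univ hH, setLIntegral_univ]
    _ = wordMeasure p H := by
      rw [hcomp, Measure.map_apply hgraph (MeasurableSet.univ.prod hH)]
      congr 1
      ext ω
      simp

/-- Otherwise tolerances tending to zero would produce, by compactness, a unit map whose slow set
has mass at least one half, yet that set is null. -/
theorem exists_uniform_slowSet_bound (p : PMF Λ) (hp : ∀ i, 0 < p i)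
    (hφ : ∀ i, ∃ K : ℝ≥0, ContractingWith K (φ i)) (hfix : ¬ ∃ x, ∀ i, φ i x = x)
    (hnc : NonConformal φ) (hirr : TotallyIrreducible φ) :
    ∃ t : ℝ, 0 < t ∧ ∀ ψ : AffVec, ‖ψ‖ = 1 →
      (wordMeasure p).real (slowSet φ t ψ) ≤ 1 / 2 := by
  by_contra hcon
  push Not at hcon
  choose ψ hψ hlt using fun k : ℕ => hcon (1 / ((k : ℝ) + 1)) (by positivity)
  obtain ⟨ψ₀, hψ₀, h⟩ := exists_unit_slowSet_limit hφ p hψ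
    tendsto_one_div_add_atTop_nhds_zero_nat (tendsto_const_nhds (x := (1 / 2 : ℝ)))
    fun k => (hlt k).le
  have h0 : ψ₀ ≠ 0 := by
    rintro rfl
    simp at hψ₀
  rw [measureReal_def, measure_slowSet_eq_zero p hp hφ hfix hnc hirr h0] at h
  norm_num at h

theorem measureReal_slowSet_le (p : PMF Λ) {t r s : ℝ} (ht : 0 < t) (hr : 0 < r)
    (hs : s ≤ t * r)
    (hunif : ∀ ψ : AffVec, ‖ψ‖ = 1 → (wordMeasure p).real (slowSet φ t ψ) ≤ 1 / 2)
    {ψ : AffVec} (hψ : r ≤ ‖ψ‖) : (wordMeasure p).real (slowSet φ s ψ) ≤ 1 / 2 := by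
  have hpos : 0 < ‖ψ‖ := hr.trans_le hψ
  have h1 : slowSet φ s ψ ⊆ slowSet φ t (‖ψ‖⁻¹ • ψ) := by
    intro ω hω
    have h2 : |‖ψ‖⁻¹| * s ≤ t := by
      rw [abs_of_pos (by positivity), inv_mul_le_iff₀ hpos, mul_comm ‖ψ‖]
      exact hs.trans (by gcongr)
    have h3 : ω ∈ slowSet φ (|‖ψ‖⁻¹| * s) (‖ψ‖⁻¹ • ψ) := slowSet_smul_subset _ _ hω
    exact GrowthLE.mono h3 h2
  have h2 : ‖‖ψ‖⁻¹ • ψ‖ = 1 := by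
    rw [norm_smul, norm_inv, norm_norm, inv_mul_cancel₀ hpos.ne']
  exact (measureReal_mono h1 (measure_ne_top _ _)).trans (hunif _ h2)

/-- The triples `(ψ, ψ', ω)` such that `ψ - ψ'` maps the point of `ω` near the slow direction. -/
theorem measurableSet_slow_pairs (hφ : ∀ i, ∃ K : ℝ≥0, ContractingWith K (φ i)) (t : ℝ) :
    MeasurableSet {q : (AffVec × AffVec) × (ℕ → Λ) | q.2 ∈ slowSet φ t (q.1.1 - q.1.2)} := by
  have hcod := measurable_codingMap φ hφ
  have hev : Measurable fun q : AffVec × Plane => q.1 q.2 := continuous_affVec_apply.measurable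
  have h1 : Measurable fun q : (AffVec × AffVec) × (ℕ → Λ) => (q.1.1, codingMap φ q.2) := by
    fun_prop
  have h2 : Measurable fun q : (AffVec × AffVec) × (ℕ → Λ) => (q.1.2, codingMap φ q.2) := by
    fun_prop
  have h3 := (hev.comp h1).sub (hev.comp h2)
  exact measurableSet_growthLE measurable_snd h3 t

/-- Taking a difference removes the unknown translation `v` and doubles the error. -/
theorem mem_slowSet_sub_of_thickening {ω : ℕ → Λ} {δ : ℝ} {V : Submodule ℝ Plane}
    (hV : V ≤ slowSpace φ ω) {v : Plane} {ψ ψ' : AffVec}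
    (h : ψ (codingMap φ ω) ∈ Metric.thickening δ ((fun w : Plane => w + v) '' (V : Set Plane)))
    (h' : ψ' (codingMap φ ω) ∈ Metric.thickening δ ((fun w : Plane => w + v) '' (V : Set Plane))) :
    ω ∈ slowSet φ (2 * δ) (ψ - ψ') := by
  obtain ⟨_, ⟨a, ha, rfl⟩, had⟩ := Metric.mem_thickening_iff.1 h
  obtain ⟨_, ⟨a', ha', rfl⟩, had'⟩ := Metric.mem_thickening_iff.1 h'
  have h1 : GrowthLE φ ω 0 (a - a') := hV (V.sub_mem ha ha')
  rw [dist_eq_norm] at had had'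
  have h2 : ‖(ψ (codingMap φ ω) - ψ' (codingMap φ ω)) - (a - a')‖ ≤ 2 * δ := by
    have e : (ψ (codingMap φ ω) - ψ' (codingMap φ ω)) - (a - a') =
        (ψ (codingMap φ ω) - (a + v)) - (ψ' (codingMap φ ω) - (a' + v)) := by abel
    rw [e]
    refine (norm_sub_le _ _).trans ?_
    dsimp only at had had'
    linarith
  have h3 := h1.of_norm_sub_le h2
  rw [zero_add] at h3
  exact h3

theorem measureReal_evalMeasure (θ : Measure AffVec) (x : Plane) {s : Set Plane} (hs : IsOpen s) :
    (evalMeasure θ x).real s = θ.real {ψ | ψ x ∈ s} := by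
  have hev : Measurable fun ψ : AffVec => ψ x :=
    (continuous_affVec_apply.comp (continuous_id.prodMk continuous_const)).measurable
  rw [evalMeasure, map_measureReal_apply hev hs.measurableSet]
  rfl

/-- If most horizontal sections of a set are large, then few vertical sections are small. -/
theorem measureReal_le_of_sections {X Y : Type*} [MeasurableSpace X] [MeasurableSpace Y]
    (θ : Measure X) (ξ : Measure Y) [IsProbabilityMeasure θ] [IsProbabilityMeasure ξ]
    {A : Set (X × Y)} (hA : MeasurableSet A) {F : Set X} {δ : ℝ} (hδ0 : 0 < δ) (hδ1 : δ ≤ 1 / 2)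
    (h : 1 - δ ≤ ξ.real {y | 1 - 2 * δ ≤ θ.real {x | (x, y) ∈ A}})
    (hF : ∀ x ∈ F, ξ.real {y | (x, y) ∈ A} ≤ 1 / 2) : θ.real F ≤ 6 * δ := by
  have hlow : (1 - 2 * δ) * (1 - δ) ≤ (θ.prod ξ).real A := by
    have h1 := mul_meas_ge_le_lintegral (μ := ξ) (measurable_measure_prodMk_right (μ := θ) hA)
      (ENNReal.ofReal (1 - 2 * δ))
    rw [← Measure.prod_apply_symm hA] at h1
    have h2 : {y | 1 - 2 * δ ≤ θ.real {x | (x, y) ∈ A}} =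
        {y | ENNReal.ofReal (1 - 2 * δ) ≤ θ ((fun x => (x, y)) ⁻¹' A)} := by
      ext y
      exact (ENNReal.ofReal_le_iff_le_toReal (measure_ne_top _ _)).symm
    rw [h2] at h
    have h3 := ENNReal.toReal_mono (measure_ne_top _ _) h1
    rw [ENNReal.toReal_mul, ENNReal.toReal_ofReal (by linarith)] at h3
    refine le_trans ?_ h3
    exact mul_le_mul_of_nonneg_left h (by linarith)
  have hup : 1 / 2 * θ.real F ≤ (θ.prod ξ).real Aᶜ := by
    have h1 := mul_meas_ge_le_lintegral (μ := θ)
      (measurable_measure_prodMk_left (ν := ξ) hA.compl) (ENNReal.ofReal (1 / 2))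
    rw [← Measure.prod_apply hA.compl] at h1
    have h2 : F ⊆ {x | ENNReal.ofReal (1 / 2) ≤ ξ (Prod.mk x ⁻¹' Aᶜ)} := by
      intro x hx
      refine ENNReal.ofReal_le_of_le_toReal ?_
      have h4 : ξ.real (Prod.mk x ⁻¹' Aᶜ) = 1 - ξ.real {y | (x, y) ∈ A} :=
        probReal_compl_eq_one_sub (measurable_prodMk_left hA)
      rw [← measureReal_def, h4]
      linarith [hF x hx]
    have h3 := ENNReal.toReal_mono (measure_ne_top _ _) h1
    rw [ENNReal.toReal_mul, ENNReal.toReal_ofReal (by norm_num)] at h3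
    refine le_trans ?_ h3
    exact mul_le_mul_of_nonneg_left (measureReal_mono h2 (measure_ne_top _ _)) (by norm_num)
  -- Half the mass of `F` is at most `1 - (1 - 2δ)(1 - δ) ≤ 3δ`.
  rw [probReal_compl_eq_one_sub hA] at hup
  nlinarith

/-- Some slice has mass at most the average over all slices. -/
theorem exists_measureReal_far_le {θ : Measure AffVec} [IsProbabilityMeasure θ] {r c : ℝ}
    (h : (θ.prod θ).real {q | r ≤ ‖q.1 - q.2‖} ≤ c) :
    ∃ ψ₀ : AffVec, θ.real {ψ | r ≤ ‖ψ₀ - ψ‖} ≤ c := by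
  have hm : MeasurableSet {q : AffVec × AffVec | r ≤ ‖q.1 - q.2‖} :=
    (isClosed_le continuous_const (continuous_fst.sub continuous_snd).norm).measurableSet
  have h1 := Measure.prod_apply (μ := θ) (ν := θ) hm
  obtain ⟨ψ₀, hψ₀⟩ := exists_le_lintegral (μ := θ)
    (measurable_measure_prodMk_left (ν := θ) hm).aemeasurable
  refine ⟨ψ₀, le_trans ?_ h⟩
  rw [← h1] at hψ₀
  exact ENNReal.toReal_mono (measure_ne_top _ _) hψ₀

theorem isConcentrated_bot {θ : Measure AffVec} [IsProbabilityMeasure θ] {r c ε C : ℝ}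
    {ψ₀ : AffVec} (hψ₀ : θ.real {ψ | r ≤ ‖ψ₀ - ψ‖} ≤ c) (hcε : c ≤ ε) (hr : r * (C + 1) ≤ ε)
    {x : Plane} (hx : ‖x‖ ≤ C) : IsConcentrated ⊥ ε (evalMeasure θ x) := by
  refine ⟨ψ₀ x, ?_⟩
  rw [measureReal_evalMeasure θ x Metric.isOpen_thickening]
  have hm : MeasurableSet {ψ : AffVec | r ≤ ‖ψ₀ - ψ‖} :=
    (isClosed_le continuous_const (continuous_const.sub continuous_id).norm).measurableSet
  have h1 : {ψ : AffVec | r ≤ ‖ψ₀ - ψ‖}ᶜ ⊆ {ψ | ψ x ∈ Metric.thickening ε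
      ((fun w : Plane => w + ψ₀ x) '' ((⊥ : Submodule ℝ Plane) : Set Plane))} := by
    intro ψ hψ
    have hψ' : ‖ψ₀ - ψ‖ < r := not_le.1 hψ
    refine Metric.mem_thickening_iff.2 ⟨ψ₀ x, ⟨0, by simp, zero_add _⟩, ?_⟩
    rw [dist_comm, dist_eq_norm]
    have h2 : ‖ψ₀ x - ψ x‖ ≤ ‖ψ₀ - ψ‖ * (‖x‖ + 1) := norm_affVec_apply_le (ψ₀ - ψ) x
    have h3 : ‖ψ₀ - ψ‖ * (‖x‖ + 1) < r * (‖x‖ + 1) := by gcongr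
    have h4 : r * (‖x‖ + 1) ≤ r * (C + 1) := by
      have : 0 < r := (norm_nonneg _).trans_lt hψ'
      gcongr
    linarith
  have h2 := measureReal_mono (μ := θ) h1 (measure_ne_top _ _)
  rw [probReal_compl_eq_one_sub hm] at h2
  linarith

end Disintegration


theorem corollary5p10 {Λ : Type*} [Fintype Λ] [Nonempty Λ] [MeasurableSpace Λ]
    [DiscreteMeasurableSpace Λ] (φ : Λ → Plane ≃ᵃ[ℝ] Plane) (p : PMF Λ)
    (hφ : ∀ i, ∃ K : ℝ≥0, ContractingWith K (φ i))
    (hfix : ¬ ∃ x, ∀ i, φ i x = x)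
    (hp : ∀ i, 0 < p i)
    (hnc : NonConformal φ)
    (hirr : TotallyIrreducible φ)
    (hdim : measureDim (selfAffineMeasure φ p) < 2) :
    (∀ ψ : AffVec, ψ ≠ 0 →
      selfAffineMeasure φ p
        {x | ∃ h : ψ x ≠ 0, IsDirectionAt φ p x (Projectivization.mk ℝ (ψ x) h)} = 0) ∧
    (∀ ε R : ℝ, 0 < ε → 0 < R → ∃ δ : ℝ, 0 < δ ∧
      ∀ θ : Measure AffVec, IsProbabilityMeasure θ → SupportedInDiam θ R →
        ε < (selfAffineMeasure φ p).real {x | ¬ IsConcentrated ⊥ ε (evalMeasure θ x)} →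
        (selfAffineMeasure φ p).real
          {x | ∃ V : RP1, IsDirectionAt φ p x V ∧
            IsConcentrated V.submodule δ (evalMeasure θ x)} ≤ 1 - δ) := by
  have hdir := ae_wordDirection_le_slowSpace p hp hnc hirr
  refine ⟨fun ψ hψ => ?_, fun ε R hε _ => ?_⟩
  · refine le_antisymm ?_ zero_le
    rw [← measure_slowSet_eq_zero p hp hφ hfix hnc hirr hψ]
    refine selfAffineMeasure_le_of_condDistrib p hφ hdir (measurableSet_slowSet hφ 0 ψ) ?_
    rintro x ⟨h, hx⟩
    filter_upwards [hx] with ω hω hωx hle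
    have h1 : ψ x ∈ (Projectivization.mk ℝ (ψ x) h).submodule := by
      rw [Projectivization.submodule_mk]
      exact Submodule.mem_span_singleton_self _
    have h2 : ψ (codingMap φ ω) ∈ slowSpace φ ω := by
      rw [hωx]
      exact hle _ hω h1
    exact h2
  · obtain ⟨C₀, hC₀⟩ := exists_codingMap_bound φ hφ
    set C := max C₀ 0
    have hC : ∀ ω, ‖codingMap φ ω‖ ≤ C := fun ω => (hC₀ ω).2.trans (le_max_left _ _)
    have hC0 : 0 ≤ C := le_max_right _ _
    obtain ⟨t, ht, hunif⟩ := exists_uniform_slowSet_bound p hp hφ hfix hnc hirr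
    -- Maps within `r` of each other differ by less than `ε` on the ball of radius `C`. The bounds
    -- on `δ` make `2δ` a tolerance covered by the uniform estimate for differences of norm at least
    -- `r`, and make the Fubini loss `6δ` at most `ε`.
    set r := ε / (C + 1)
    have hr : 0 < r := by positivity
    set δ := min (min (t * r / 2) (ε / 6)) (1 / 2)
    have hδ0 : 0 < δ := by positivity
    have hδt : 2 * δ ≤ t * r := by
      have : δ ≤ t * r / 2 := (min_le_left _ _).trans (min_le_left _ _)
      linarith
    have hδε : 6 * δ ≤ ε := by
      have : δ ≤ ε / 6 := (min_le_left _ _).trans (min_le_right _ _)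
      linarith
    have hδ1 : δ ≤ 1 / 2 := min_le_right _ _
    refine ⟨δ, hδ0, fun θ hθ _ hnot => ?_⟩
    by_contra hcon
    push Not at hcon
    have hA := measurableSet_slow_pairs hφ (2 * δ)
    set A : Set ((AffVec × AffVec) × (ℕ → Λ)) := {q | q.2 ∈ slowSet φ (2 * δ) (q.1.1 - q.1.2)}
    set H : Set (ℕ → Λ) := {ω | 1 - 2 * δ ≤ (θ.prod θ).real {q | (q, ω) ∈ A}}
    have hH : MeasurableSet H := measurableSet_le measurable_const
      (measurable_measure_prodMk_right (μ := θ.prod θ) hA).ennreal_toReal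
    have hle := selfAffineMeasure_le_of_condDistrib p hφ hdir hH
      (E := {x | ∃ V : RP1, IsDirectionAt φ p x V ∧
        IsConcentrated V.submodule δ (evalMeasure θ x)}) (by
      rintro x ⟨V, hV, v, hv⟩
      filter_upwards [hV] with ω hω hωx hslow
      rw [measureReal_evalMeasure θ x Metric.isOpen_thickening] at hv
      set G : Set AffVec := {ψ | ψ x ∈ Metric.thickening δ
        ((fun w : Plane => w + v) '' (V.submodule : Set Plane))}
      have hGG : G ×ˢ G ⊆ {q | (q, ω) ∈ A} := by
        rintro ⟨ψ, ψ'⟩ ⟨h1, h2⟩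
        subst hωx
        exact mem_slowSet_sub_of_thickening (hslow V hω) h1 h2
      -- Two independent samples both fall in `G` with probability at least `(1 - δ)² ≥ 1 - 2δ`.
      have h1 := measureReal_mono (μ := θ.prod θ) hGG (measure_ne_top _ _)
      rw [measureReal_prod_prod] at h1
      change 1 - 2 * δ ≤ _
      nlinarith)
    have hHδ : 1 - δ ≤ (wordMeasure p).real H :=
      hcon.le.trans (ENNReal.toReal_mono (measure_ne_top _ _) hle)
    have hfar := measureReal_le_of_sections (θ.prod θ) (wordMeasure p) hA
      (F := {q | r ≤ ‖q.1 - q.2‖}) hδ0 hδ1 hHδ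
      (fun q hq => by
        have hq' : r ≤ ‖q.1 - q.2‖ := hq
        have hsec : {ω | (q, ω) ∈ A} = slowSet φ (2 * δ) (q.1 - q.2) := rfl
        rw [hsec]
        exact measureReal_slowSet_le p ht hr hδt hunif hq')
    obtain ⟨ψ₀, hψ₀⟩ := exists_measureReal_far_le hfar
    have hrC : r * (C + 1) ≤ ε := (div_mul_cancel₀ ε (by positivity)).le
    -- Since `θ` gives mass at least `1 - ε` to the maps within `r` of `ψ₀`, the measure `θ.x` is
    -- concentrated at every point of the ball of radius `C`, which carries `μ`.
    have hzero : selfAffineMeasure φ p {x | ¬ IsConcentrated ⊥ ε (evalMeasure θ x)} = 0 := by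
      refine measure_mono_null (t := {x | ¬ ‖x‖ ≤ C})
        (fun x hx hxC => hx (isConcentrated_bot hψ₀ hδε hrC hxC)) ?_
      have hm : MeasurableSet {x : Plane | ¬ ‖x‖ ≤ C} :=
        (measurableSet_le measurable_norm measurable_const).compl
      rw [selfAffineMeasure, Measure.map_apply (measurable_codingMap φ hφ) hm]
      convert measure_empty (μ := wordMeasure p)
      ext ω
      simp [hC ω]
    rw [measureReal_def, hzero, ENNReal.toReal_zero] at hnot
    linarith
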